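/- A partial monitoring game with $k$ actions and $d$ outcomes consists of a loss matrix $\mathcal{L}\in[0,1]^{k\times d}$ with rows $\ell_1,\dots,\ell_k$ and a feedback matrix $\Phi\in\Sigma^{k\times d}$ over a set of symbols $\Sigma$; $m$ denotes the maximum number of distinct symbols in a single row of $\Phi$. Let $\mathcal{P}_n$ be the probability simplex in $\mathbb{R}^n$. The cell of action $a$ is $\mathcal{C}_a=\{u\in\mathcal{P}_d : (\ell_a-\ell_b)^\top u\le 0 \text{ for all } b\in[k]\}$, and $\dim$ denotes the dimension of the affine hull. An action $a$ with $\mathcal{C}_a\ne\emptyset$ is Pareto optimal if $\dim\mathcal{C}_a=d-1$ and degenerate if $\dim\mathcal{C}_a<d-1$; $\Pi$ is the set of Pareto optimal actions. Actions $a\neq b$ are duplicate if $\ell_a=\ell_b$. Two actions $a,b\in\Pi$ are neighbours if $\mathcal{C}_a\cap\mathcal{C}_b\neq\emptyset$ and $\dim(\mathcal{C}_a\cap\mathcal{C}_b)=d-2$. The game is non-degenerate if it has no degenerate action, and locally observable if for all neighbours $a,b$ there is $w\colon[k]\times\Sigma\to\mathbb{R}$ with $\sum_{c=1}^k w(c,\Phi_{cx})=\mathcal{L}_{ax}-\mathcal{L}_{bx}$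 for all $x\in[d]$ and $w(c,\sigma)=0$ for all $c\notin\{a,b\}$ and $\sigma\in\Sigma$. Let $\mathcal{H}^\circ$ be the set of all $G\colon[k]\times\Sigma\to\mathbb{R}^k$ with $\sum_{a=1}^k\bigl(G(a,\Phi_{ax})_b-G(a,\Phi_{ax})_c\bigr)=\mathcal{L}_{bx}-\mathcal{L}_{cx}$ for all $b,c\in\Pi$ and $x\in[d]$. For $\gamma\in\mathbb{R}$ let $\phi(x)=(-\log x+x-1)+\gamma\bigl((1-x)\log(1-x)+x\bigr)$ on $(0,1]$ (with $0\log0=0$) and $\phi=+\infty$ elsewhere, let $\phi^*(s)=\sup_y\,(sy-\phi(y))$ be its convex conjugate, let $D_f(x,y)=f(x)-f(y)-f'(y)(x-y)$, and for $r\in(0,1)$ let $\mathcal{S}_r(z)=D_{\phi^*}(\phi'(r)-z,\,\phi'(r))$. For $q\in\mathcal{P}_k$ with $0<q_b<1$ for all $b\in[k]$, and $\beta\in(0,\infty)^k$, let $\mathcal{R}(q)=\{p\in\mathcal{P}_k : p_a\ge q_a/2 \text{ for all } a\in[k]\}$ and $$\mathrm{OPT}_q(\beta)=\inf_{p\in\mathcal{R}(q),\,G\in\mathcal{H}^\circ}\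 \max_{x\in[d]}\Bigl[(p-q)^\top\mathcal{L}e_x+\sum_{b=1}^k\beta_b\sum_{a=1}^k p_a\,\mathcal{S}_{q_b}\Bigl(\frac{G(a,\Phi_{ax})_b}{\beta_b\,p_a}\Bigr)\Bigr].$$ **Lemma.** Consider a non-degenerate, locally observable partial monitoring game without duplicate actions. Suppose that $\gamma\ge2$ and $\beta_b\ge4mk$ for all $b\in[k]$. Then for every $q\in\mathcal{P}_k$ with $0<q_b<1$ for all $b\in[k]$, $$\mathrm{OPT}_q(\beta)\le 2m^2k^2\sum_{b=1}^k\frac1{\beta_b}\min\Bigl\{q_b,\frac{1-q_b}{\gamma q_b}\Bigr\}.$$ -/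

import Mathlib

noncomputable section

/-- A finite partial monitoring game with `k` actions, `d` outcomes and feedback symbols in `S`:
a loss matrix with entries in `[0, 1]` and a feedback matrix. -/
structure PMGame (k d : ℕ) (S : Type*) where
  loss : Fin k → Fin d → ℝ
  feedback : Fin k → Fin d → S
  loss_mem : ∀ a x, loss a x ∈ Set.Icc (0 : ℝ) 1

namespace PMGame

variable {k d : ℕ} {S : Type*}

/-- The maximum, over the actions, of the number of distinct symbols in the row of that action. -/
def maxSymbols (𝒢 : PMGame k d S) : ℕ :=
  Finset.univ.sup fun a : Fin k => (Set.range (𝒢.feedback a)).ncard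

/-- Two different actions are duplicate if their loss vectors agree. -/
def HasNoDuplicates (𝒢 : PMGame k d S) : Prop :=
  ∀ a b : Fin k, a ≠ b → 𝒢.loss a ≠ 𝒢.loss b

/-- The cell of `a`: the outcome distributions for which `a` is an optimal action. -/
def cell (𝒢 : PMGame k d S) (a : Fin k) : Set (Fin d → ℝ) :=
  {u | u ∈ stdSimplex ℝ (Fin d) ∧ ∀ b : Fin k, ∑ x, (𝒢.loss a x - 𝒢.loss b x) * u x ≤ 0}

/-- The dimension of the affine hull of a set (only used for nonempty sets). -/
def affDim (s : Set (Fin d → ℝ)) : ℕ :=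
  Module.finrank ℝ (affineSpan ℝ s).direction

/-- Pareto optimal actions: the cell is nonempty of dimension `d - 1`. -/
def IsPareto (𝒢 : PMGame k d S) (a : Fin k) : Prop :=
  (𝒢.cell a).Nonempty ∧ affDim (𝒢.cell a) + 1 = d

/-- Degenerate actions: the cell is nonempty of dimension less than `d - 1`. -/
def IsDegenerate (𝒢 : PMGame k d S) (a : Fin k) : Prop :=
  (𝒢.cell a).Nonempty ∧ affDim (𝒢.cell a) + 1 < d

/-- A game is non-degenerate if it has no degenerate action. -/
def NonDegenerate (𝒢 : PMGame k d S) : Prop :=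
  ∀ a : Fin k, ¬ 𝒢.IsDegenerate a

/-- Neighbouring actions: Pareto optimal actions whose cells meet in dimension `d - 2`. -/
def Neighbors (𝒢 : PMGame k d S) (a b : Fin k) : Prop :=
  𝒢.IsPareto a ∧ 𝒢.IsPareto b ∧ (𝒢.cell a ∩ 𝒢.cell b).Nonempty ∧
    affDim (𝒢.cell a ∩ 𝒢.cell b) + 2 = d

/-- Local observability: the loss difference of any two neighbouring actions `a` and `b` can be
estimated from the feedback of `a` and `b` alone. -/
def LocallyObservable (𝒢 : PMGame k d S) : Prop :=
  ∀ a b : Fin k, 𝒢.Neighbors a b →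
    ∃ w : Fin k → S → ℝ,
      (∀ x, ∑ c, w c (𝒢.feedback c x) = 𝒢.loss a x - 𝒢.loss b x) ∧
      ∀ c, c ≠ a → c ≠ b → ∀ σ, w c σ = 0

/-- The functions `G : [k] × S → ℝ^k` that estimate all loss differences of Pareto optimal
actions. -/
def lossDiffEstimators (𝒢 : PMGame k d S) : Set (Fin k → S → Fin k → ℝ) :=
  {G | ∀ b c : Fin k, 𝒢.IsPareto b → 𝒢.IsPareto c → ∀ x,
    ∑ a, (G a (𝒢.feedback a x) b - G a (𝒢.feedback a x) c) = 𝒢.loss b x - 𝒢.loss c x}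

end PMGame

/-- The convex conjugate of the function that is `f` on `D` and `+∞` outside `D`. -/
def convexConj (D : Set ℝ) (f : ℝ → ℝ) (s : ℝ) : ℝ :=
  sSup ((fun y => s * y - f y) '' D)

/-- The Bregman divergence `D_f(x, y)` on the real line. -/
def bregman (f : ℝ → ℝ) (x y : ℝ) : ℝ :=
  f x - f y - deriv f y * (x - y)

/-- The component of the hybrid regularizer (log-barrier and complement Shannon entropy); its
domain is `(0, 1]`, with `0 log 0 = 0`. -/
def hybrid (γ x : ℝ) : ℝ :=
  (-Real.log x + x - 1) + γ * ((1 - x) * Real.log (1 - x) + x)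

/-- The stability function `z ↦ D_{φ*}(φ'(q) - z, φ'(q))` of `φ = hybrid γ` at `q ∈ (0, 1)`. -/
def stab (γ q z : ℝ) : ℝ :=
  bregman (convexConj (Set.Ioc 0 1) (hybrid γ)) (deriv (hybrid γ) q - z) (deriv (hybrid γ) q)

/-- The half-truncated simplex `{p : p ≥ q / 2}`. -/
def halfSimplex {k : ℕ} (q : Fin k → ℝ) : Set (Fin k → ℝ) :=
  {p | p ∈ stdSimplex ℝ (Fin k) ∧ ∀ a, q a / 2 ≤ p a}

namespace PMGame

variable {k d : ℕ} {S : Type*}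

/-- The objective of exploration by optimization with the hybrid regularizer: the worst case over
the outcomes of the transformation term plus the stability term. -/
def exoObjective (𝒢 : PMGame k d S) (γ : ℝ) (β q p : Fin k → ℝ) (G : Fin k → S → Fin k → ℝ) : ℝ :=
  ⨆ x : Fin d, (∑ a, (p a - q a) * 𝒢.loss a x +
    ∑ b, β b * ∑ a, p a * stab γ (q b) (G a (𝒢.feedback a x) b / (β b * p a)))

/-- The optimal value of exploration by optimization over `p ∈ halfSimplex q` and all loss
difference estimators `G`. The infimum is taken in the extended reals, so that it has no junk
value. -/
def exoOpt (𝒢 : PMGame k d S) (γ : ℝ) (β q : Fin k → ℝ) : EReal :=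
  ⨅ p ∈ halfSimplex q, ⨅ G ∈ 𝒢.lossDiffEstimators, (𝒢.exoObjective γ β q p G : EReal)

end PMGame

end

/-! The objective is jointly convex in `(p, G)` for each outcome, since the stability function is a
supremum of affine functions and its perspective is therefore convex. By the theorem of the
alternative `exists_forall_neg_of_convexOn` it then suffices to answer each fixed outcome
distribution `lam` (`exists_exploration`).

Against `lam`, fix an optimal action `root`. The difference of `b` and `root` is estimated by
walking through neighbouring cells and adding bounded two-action estimators
(`LocallyObservable.exists_bounded`). The essential bound is `exists_estimator_of_mem_cell`: the
sizes sum to at most `4/3 * k`, even when each action is charged its regret relative to that of `b`.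
It comes from a covering argument on the shortest-path potential (`potential_sub_le`). Two long
links at one action would be expensive, but `reflTransGen_bypass` shows that the action can then be
circumvented through actions of moderate regret.

The distribution `p` keeps half of `q`, spreads the other half in proportion to these sizes, and
puts the remainder on `root`; this does not raise the loss at `lam` by more than `ε`. In the
stability term a common shift of the estimates nearly cancels the cubic error (`exists_stab_shift`).
This leaves `9/32 * v ^ 2` with `v = 8/3 * m * k / β`, which gives the constant `2`. -/

noncomputable section

/-! ### Bounds and convexity of the stability function of the hybrid regularizer. -/

section StabilityFunction

open Set Real

theorem hasDerivAt_hybrid {γ q : ℝ} (h0 : 0 < q) (h1 : q < 1) :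
    HasDerivAt (hybrid γ) (-q⁻¹ + 1 - γ * log (1 - q)) q := by
  have h2 : HasDerivAt (fun x : ℝ => 1 - x) (-1) q := by
    simpa using (hasDerivAt_id q).const_sub 1
  have h3 := (h2.mul (h2.log (by linarith : (1 - q) ≠ 0))).add (hasDerivAt_id q)
  have h4 := (((hasDerivAt_log h0.ne').neg.add (hasDerivAt_id q)).sub_const 1).add
    (h3.const_mul γ)
  refine h4.congr_deriv ?_
  have : 1 - q ≠ 0 := by linarith
  field_simp
  ring

/-- The Bregman divergence of the hybrid regularizer, written in closed form. -/
def hybridDiv (γ q y : ℝ) : ℝ :=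
  (y / q - 1 - log (y / q)) + γ * ((1 - y) * log ((1 - y) / (1 - q)) - (1 - y) + (1 - q))

theorem sub_one_sub_log_nonneg {t : ℝ} (ht : 0 < t) : 0 ≤ t - 1 - log t := by
  linarith [log_le_sub_one_of_pos ht]

/-- The Fenchel–Young inequality for the entropy, from `log t ≤ t - 1` at `t = R * exp x / Y`. The
case `Y = 0` is the endpoint `y = 1` of the domain. -/
theorem mul_sub_entropy_le {Y R : ℝ} (hY : 0 ≤ Y) (hR : 0 < R) (x : ℝ) :
    x * (Y - R) - (Y * log (Y / R) - Y + R) ≤ R * (exp x - 1 - x) := by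
  rcases hY.eq_or_lt with rfl | hY
  · have := exp_pos x
    simp only [zero_div, log_zero, mul_zero, zero_sub]
    nlinarith
  · have h := log_le_sub_one_of_pos (show 0 < R * exp x / Y by positivity)
    rw [log_div (by positivity) hY.ne', log_mul hR.ne' (exp_pos x).ne', log_exp] at h
    rw [log_div hY.ne' hR.ne']
    have h' : Y * (log R + x - log Y) ≤ Y * (R * exp x / Y - 1) := mul_le_mul_of_nonneg_left h hY.le
    have : Y * (R * exp x / Y - 1) = R * exp x - Y := by field_simp
    nlinarith

theorem entropy_nonneg {Y R : ℝ} (hY : 0 ≤ Y) (hR : 0 < R) :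
    0 ≤ Y * log (Y / R) - Y + R := by
  have := mul_sub_entropy_le hY hR 0
  simp at this
  linarith

/-- The Fenchel–Young inequality for the log-barrier, from `log t ≤ t - 1` at `t = (1 + z * q) * (y
/ q)`. -/
theorem mul_sub_logDiv_le {q y z : ℝ} (h0 : 0 < q) (hy : 0 < y) (hz : -1 < z * q) :
    z * (q - y) - (y / q - 1 - log (y / q)) ≤ z * q - log (1 + z * q) := by
  have h1 : 0 < 1 + z * q := by linarith
  have h2 : 0 < y / q := by positivity
  have h := log_le_sub_one_of_pos (mul_pos h1 h2)
  rw [log_mul h1.ne' h2.ne'] at h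
  have : (1 + z * q) * (y / q) = y / q + z * y := by field_simp
  linarith

section

variable {γ q : ℝ}

theorem hybridDiv_nonneg (hγ : 0 ≤ γ) (h0 : 0 < q) (h1 : q < 1) {y : ℝ} (hy : y ∈ Ioc (0 : ℝ) 1) :
    0 ≤ hybridDiv γ q y :=
  add_nonneg (sub_one_sub_log_nonneg (div_pos hy.1 h0))
    (mul_nonneg hγ (entropy_nonneg (by linarith [hy.2]) (by linarith)))

theorem hybridDiv_self (h0 : 0 < q) (h1 : q < 1) : hybridDiv γ q q = 0 := by
  have : 1 - q ≠ 0 := by linarith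
  simp [hybridDiv, h0.ne', this]

theorem hybrid_eq (h0 : 0 < q) (h1 : q < 1) {y : ℝ} (hy : y ∈ Ioc (0 : ℝ) 1) :
    hybrid γ y = hybrid γ q + deriv (hybrid γ) q * (y - q) + hybridDiv γ q y := by
  rw [(hasDerivAt_hybrid h0 h1).deriv]
  have h2 : (1 : ℝ) - q ≠ 0 := by linarith
  have h3 : (1 - y) * log ((1 - y) / (1 - q)) = (1 - y) * (log (1 - y) - log (1 - q)) := by
    rcases hy.2.eq_or_lt with rfl | hy1
    · simp
    · rw [log_div (by linarith) h2]
  rw [hybridDiv, h3, log_div hy.1.ne' h0.ne', hybrid, hybrid]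
  field_simp
  ring

/-- Boundedness of the image rules out the default value of `sSup`, so the conjugate is a genuine
supremum. -/
theorem convexConj_hybrid_isLUB (hγ : 0 ≤ γ) (h0 : 0 < q) (h1 : q < 1) (z : ℝ) :
    IsLUB ((fun y => (deriv (hybrid γ) q - z) * y - hybrid γ y) '' Ioc 0 1)
      (convexConj (Ioc 0 1) (hybrid γ) (deriv (hybrid γ) q - z)) := by
  refine isLUB_csSup ⟨_, mem_image_of_mem _ ⟨h0, h1.le⟩⟩
    ⟨deriv (hybrid γ) q * q - hybrid γ q + |z|, ?_⟩
  rintro _ ⟨y, hy, rfl⟩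
  have h2 := hybridDiv_nonneg hγ h0 h1 hy
  have h3 : -(z * y) ≤ |z| := by
    calc -(z * y) ≤ |z * y| := neg_le_abs _
      _ = |z| * y := by rw [abs_mul, abs_of_pos hy.1]
      _ ≤ |z| := mul_le_of_le_one_right (abs_nonneg z) hy.2
  simp only [hybrid_eq (γ := γ) h0 h1 hy]
  nlinarith

theorem convexConj_hybrid_self (hγ : 0 ≤ γ) (h0 : 0 < q) (h1 : q < 1) :
    convexConj (Ioc 0 1) (hybrid γ) (deriv (hybrid γ) q) =
      deriv (hybrid γ) q * q - hybrid γ q := by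
  have h := convexConj_hybrid_isLUB hγ h0 h1 0
  simp only [sub_zero] at h
  refine le_antisymm (h.2 ?_) (h.1 ⟨q, ⟨h0, h1.le⟩, rfl⟩)
  rintro _ ⟨y, hy, rfl⟩
  have h2 := hybridDiv_nonneg hγ h0 h1 hy
  simp only [hybrid_eq (γ := γ) h0 h1 hy]
  nlinarith

theorem sub_log_one_add_le_sq {u : ℝ} (hu : |u| ≤ 1 / 2) : u - log (1 + u) ≤ 2 * u ^ 2 := by
  have h := abs_le.1 hu
  have h1 : 0 < 1 + u := by linarith
  have h2 := log_le_sub_one_of_pos (inv_pos.2 h1)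
  rw [log_inv] at h2
  have h3 : (1 + u)⁻¹ - 1 ≤ 2 * u ^ 2 - u := by
    rw [sub_le_iff_le_add, inv_le_iff_one_le_mul₀ h1]
    nlinarith [mul_nonneg (sq_nonneg u) (by linarith : 0 ≤ u + 1 / 2)]
  linarith

theorem convexConj_hybrid_le (hγ : 0 ≤ γ) (h0 : 0 < q) (h1 : q < 1) {z : ℝ} (hz : -1 < z * q) :
    convexConj (Ioc 0 1) (hybrid γ) (deriv (hybrid γ) q - z) ≤
      deriv (hybrid γ) q * q - hybrid γ q - z * q + (z * q - log (1 + z * q)) := by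
  refine (convexConj_hybrid_isLUB hγ h0 h1 z).2 ?_
  rintro _ ⟨y, hy, rfl⟩
  have h2 := mul_sub_logDiv_le h0 hy.1 hz
  have h3 := mul_nonneg hγ
    (entropy_nonneg (by linarith [hy.2] : 0 ≤ 1 - y) (by linarith : 0 < 1 - q))
  simp only [hybrid_eq (γ := γ) h0 h1 hy, hybridDiv]
  nlinarith

/-- Evaluating the supremum at `y = q` gives a linear lower bound, and the log-barrier bound exceeds
it by only a quadratic term. This is what identifies the `deriv` inside `bregman`. -/
theorem hasDerivAt_convexConj_hybrid (hγ : 0 ≤ γ) (h0 : 0 < q) (h1 : q < 1) :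
    HasDerivAt (convexConj (Ioc 0 1) (hybrid γ)) q (deriv (hybrid γ) q) := by
  rw [hasDerivAt_iff_isLittleO_nhds_zero]
  refine Asymptotics.IsBigO.trans_isLittleO (g := fun h : ℝ => h ^ 2) ?_ ?_
  · refine Asymptotics.IsBigO.of_bound 2 ?_
    filter_upwards [Metric.ball_mem_nhds (0 : ℝ) (by norm_num : (0 : ℝ) < 1 / 2)] with h hh
    rw [mem_ball_zero_iff, norm_eq_abs] at hh
    have hq : |(-h) * q| ≤ 1 / 2 := by
      rw [abs_mul, abs_neg, abs_of_pos h0]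
      nlinarith [abs_nonneg h]
    have hub := convexConj_hybrid_le hγ h0 h1 (z := -h) (by linarith [(abs_le.1 hq).1])
    have hlb := (convexConj_hybrid_isLUB hγ h0 h1 (-h)).1 ⟨q, ⟨h0, h1.le⟩, rfl⟩
    simp only [sub_neg_eq_add] at hub hlb
    rw [convexConj_hybrid_self hγ h0 h1, norm_eq_abs, norm_eq_abs, smul_eq_mul, abs_le,
      abs_of_nonneg (sq_nonneg h)]
    have hs := sub_log_one_add_le_sq hq
    have hsq : (-h * q) ^ 2 ≤ h ^ 2 := by
      have : q ^ 2 ≤ 1 := by nlinarith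
      nlinarith [sq_nonneg h]
    constructor
    · nlinarith [sq_nonneg h]
    · nlinarith [sq_nonneg h]
  · exact Asymptotics.isLittleO_pow_id (by norm_num)

theorem stab_eq (hγ : 0 ≤ γ) (h0 : 0 < q) (h1 : q < 1) (z : ℝ) :
    stab γ q z = convexConj (Ioc 0 1) (hybrid γ) (deriv (hybrid γ) q - z) -
      (deriv (hybrid γ) q * q - hybrid γ q) + z * q := by
  rw [stab, bregman, (hasDerivAt_convexConj_hybrid hγ h0 h1).deriv,
    convexConj_hybrid_self hγ h0 h1]
  ring

theorem le_stab (hγ : 0 ≤ γ) (h0 : 0 < q) (h1 : q < 1) (z : ℝ) {y : ℝ} (hy : y ∈ Ioc (0 : ℝ) 1) :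
    z * (q - y) - hybridDiv γ q y ≤ stab γ q z := by
  rw [stab_eq hγ h0 h1]
  have := (convexConj_hybrid_isLUB hγ h0 h1 z).1 ⟨y, hy, rfl⟩
  simp only [hybrid_eq (γ := γ) h0 h1 hy] at this
  nlinarith

theorem stab_le (hγ : 0 ≤ γ) (h0 : 0 < q) (h1 : q < 1) {z C : ℝ}
    (h : ∀ y ∈ Ioc (0 : ℝ) 1, z * (q - y) - hybridDiv γ q y ≤ C) : stab γ q z ≤ C := by
  rw [stab_eq hγ h0 h1]
  have : convexConj (Ioc 0 1) (hybrid γ) (deriv (hybrid γ) q - z) ≤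
      deriv (hybrid γ) q * q - hybrid γ q - z * q + C := by
    refine (convexConj_hybrid_isLUB hγ h0 h1 z).2 ?_
    rintro _ ⟨y, hy, rfl⟩
    have := h y hy
    simp only [hybrid_eq (γ := γ) h0 h1 hy]
    nlinarith
  linarith

theorem stab_nonneg (hγ : 0 ≤ γ) (h0 : 0 < q) (h1 : q < 1) (z : ℝ) : 0 ≤ stab γ q z := by
  have := le_stab hγ h0 h1 z (y := q) ⟨h0, h1.le⟩
  rwa [hybridDiv_self h0 h1, sub_self, mul_zero, sub_zero] at this

theorem stab_zero (hγ : 0 ≤ γ) (h0 : 0 < q) (h1 : q < 1) : stab γ q 0 = 0 := by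
  refine le_antisymm (stab_le hγ h0 h1 fun y hy => ?_) (stab_nonneg hγ h0 h1 0)
  have := hybridDiv_nonneg hγ h0 h1 hy
  linarith

theorem stab_le_log (hγ : 0 ≤ γ) (h0 : 0 < q) (h1 : q < 1) {z : ℝ} (hz : -1 < z * q) :
    stab γ q z ≤ z * q - log (1 + z * q) := by
  rw [stab_eq hγ h0 h1]
  linarith [convexConj_hybrid_le hγ h0 h1 hz]

theorem stab_le_exp (hγ : 0 < γ) (h0 : 0 < q) (h1 : q < 1) (z : ℝ) :
    stab γ q z ≤ γ * (1 - q) * (exp (z / γ) - 1 - z / γ) := by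
  refine stab_le hγ.le h0 h1 fun y hy => ?_
  have h2 := mul_sub_entropy_le (by linarith [hy.2] : 0 ≤ 1 - y) (by linarith : 0 < 1 - q) (z / γ)
  have h3 := mul_le_mul_of_nonneg_left h2 hγ.le
  have h4 := sub_one_sub_log_nonneg (div_pos hy.1 h0)
  have h5 : γ * (z / γ * (1 - y - (1 - q))) = z * (q - y) := by field_simp; ring
  rw [mul_sub, h5] at h3
  rw [hybridDiv]
  linarith

/-- The perspective of the stability function is subadditive. -/
theorem stab_perspective_sum_le (hγ : 0 ≤ γ) (h0 : 0 < q) (h1 : q < 1) {ι : Type*}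
    (s : Finset ι) (p g : ι → ℝ) (hp : ∀ i ∈ s, 0 ≤ p i) (hg : ∀ i ∈ s, p i = 0 → g i = 0) :
    (∑ i ∈ s, p i) * stab γ q ((∑ i ∈ s, g i) / ∑ i ∈ s, p i) ≤
      ∑ i ∈ s, p i * stab γ q (g i / p i) := by
  have hr : 0 ≤ ∑ i ∈ s, p i * stab γ q (g i / p i) :=
    Finset.sum_nonneg fun i hi => mul_nonneg (hp i hi) (stab_nonneg hγ h0 h1 _)
  rcases (Finset.sum_nonneg hp).eq_or_lt with hP | hP
  · rwa [← hP, zero_mul]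
  rw [mul_comm, ← le_div_iff₀ hP]
  -- For fixed `y` the competitor `z * (q - y) - hybridDiv γ q y` is affine in `z`, so its
  -- perspective is linear in the pair `(p i, g i)` and the sum splits termwise.
  refine stab_le hγ h0 h1 fun y hy => ?_
  rw [le_div_iff₀ hP, sub_mul, mul_right_comm, div_mul_cancel₀ _ hP.ne', Finset.sum_mul,
    Finset.mul_sum, ← Finset.sum_sub_distrib]
  refine Finset.sum_le_sum fun i hi => ?_
  rcases (hp i hi).eq_or_lt with hpi | hpi
  · rw [hg i hi hpi.symm, ← hpi]; simp
  · have := mul_le_mul_of_nonneg_left (le_stab hγ h0 h1 (g i / p i) hy) hpi.le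
    rw [mul_sub, ← mul_assoc, mul_div_cancel₀ _ hpi.ne'] at this
    linarith

theorem stab_perspective_add_le (hγ : 0 ≤ γ) (h0 : 0 < q) (h1 : q < 1) {p₁ p₂ g₁ g₂ : ℝ}
    (hp₁ : 0 ≤ p₁) (hp₂ : 0 ≤ p₂) (hg₁ : p₁ = 0 → g₁ = 0) (hg₂ : p₂ = 0 → g₂ = 0) :
    (p₁ + p₂) * stab γ q ((g₁ + g₂) / (p₁ + p₂)) ≤
      p₁ * stab γ q (g₁ / p₁) + p₂ * stab γ q (g₂ / p₂) := by
  have := stab_perspective_sum_le hγ h0 h1 Finset.univ ![p₁, p₂] ![g₁, g₂]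
    (by simp [Fin.forall_fin_two, hp₁, hp₂]) (by simpa [Fin.forall_fin_two] using ⟨hg₁, hg₂⟩)
  simpa [Fin.sum_univ_two] using this

/-- Subadditivity with the extra mass `p' - p` carrying estimate `0`, which costs nothing. It allows
the actual probability to be replaced by any lower bound. -/
theorem stab_perspective_mono (hγ : 0 ≤ γ) (h0 : 0 < q) (h1 : q < 1) {p p' g : ℝ}
    (hp : 0 ≤ p) (hpp : p ≤ p') (hg : p = 0 → g = 0) :
    p' * stab γ q (g / p') ≤ p * stab γ q (g / p) := by
  have := stab_perspective_add_le hγ h0 h1 hp (sub_nonneg.2 hpp) hg (fun _ => rfl)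
  simpa [stab_zero hγ h0 h1] using this

theorem stab_convexOn (hγ : 0 ≤ γ) (h0 : 0 < q) (h1 : q < 1) :
    ConvexOn ℝ univ (stab γ q) := by
  refine ⟨convex_univ, fun x _ y _ a b ha hb hab => ?_⟩
  have := stab_perspective_add_le hγ h0 h1 (g₁ := a * x) (g₂ := b * y) ha hb
    (fun h => by simp [h]) (fun h => by simp [h])
  rw [hab, one_mul, div_one] at this
  have e : ∀ a x : ℝ, a * stab γ q (a * x / a) = a * stab γ q x := by
    intro a x
    rcases eq_or_ne a 0 with rfl | ha
    · simp
    · rw [mul_div_cancel_left₀ _ ha]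
  simpa [e] using this

/-- In the derivative, `1 / (1 - a) = 1 + a + a ^ 2 + a ^ 3 / (1 - a)`, and `1 / (1 - a) ≤ 11 / 5`
on this range; integrating gives `11 / 20`. -/
theorem neg_log_one_sub_le {a : ℝ} (h0 : 0 ≤ a) (h1 : a ≤ 6 / 11) :
    -a - log (1 - a) ≤ a ^ 2 / 2 + a ^ 3 / 3 + 11 / 20 * a ^ 4 := by
  have key : ∀ x ∈ Ioo (0 : ℝ) (6 / 11), HasDerivAt
      (fun a : ℝ => a ^ 2 / 2 + a ^ 3 / 3 + 11 / 20 * a ^ 4 + a + log (1 - a))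
      (x + x ^ 2 + 11 / 5 * x ^ 3 + 1 - (1 - x)⁻¹) x := by
    intro x hx
    have h2 : HasDerivAt (fun x : ℝ => 1 - x) (-1) x := by
      simpa using (hasDerivAt_id x).const_sub 1
    have h3 := (((((hasDerivAt_pow 2 x).div_const 2).add ((hasDerivAt_pow 3 x).div_const 3)).add
      ((hasDerivAt_pow 4 x).const_mul (11 / 20))).add (hasDerivAt_id x)).add
      (h2.log (by linarith [hx.2] : 1 - x ≠ 0))
    refine h3.congr_deriv ?_
    norm_num
    ring
  have hm : MonotoneOn (fun a : ℝ => a ^ 2 / 2 + a ^ 3 / 3 + 11 / 20 * a ^ 4 + a + log (1 - a))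
      (Icc 0 (6 / 11)) := by
    refine monotoneOn_of_deriv_nonneg (convex_Icc _ _) ?_ ?_ ?_
    · refine ContinuousOn.add (by fun_prop) (ContinuousOn.log (by fun_prop) ?_)
      intro x hx
      linarith [hx.2]
    · rw [interior_Icc]
      exact fun x hx => (key x hx).differentiableAt.differentiableWithinAt
    · rw [interior_Icc]
      intro x hx
      rw [(key x hx).deriv, sub_nonneg, inv_le_iff_one_le_mul₀ (by linarith [hx.2])]
      have : 0 ≤ x ^ 3 * (6 / 11 - x) := mul_nonneg (pow_nonneg hx.1.le 3) (by linarith [hx.2])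
      nlinarith
  have := hm ⟨le_rfl, by norm_num⟩ ⟨h0, h1⟩ h0
  simp at this
  linarith

theorem exp_sub_le {x : ℝ} (hx : |x| ≤ 1) :
    exp x - 1 - x ≤ x ^ 2 / 2 + x ^ 3 / 6 + 5 / 96 * x ^ 4 := by
  have h := (abs_le.1 (exp_bound hx (n := 4) (by norm_num))).2
  have h4 : |x| ^ 4 = x ^ 4 := by
    rw [show |x| ^ 4 = (|x| ^ 2) ^ 2 by ring, sq_abs]; ring
  rw [h4] at h
  norm_num [Finset.sum_range_succ, Nat.factorial] at h
  linarith

/-- After a suitable common shift `u₀`, both directions of a perturbation of size `û`, together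
with the cost of compensating the shift, are bounded by `(9/16) û² r / q`. -/
theorem exists_stab_shift (hγ : 2 ≤ γ) (h0 : 0 < q) (h1 : q < 1) {v : ℝ} (hv0 : 0 ≤ v)
    (hv : v ≤ 2 / 3) :
    ∃ u₀ : ℝ,
      stab γ q ((v + u₀) / q) + stab γ q (-u₀ / q) ≤
        9 / 16 * v ^ 2 * (min q ((1 - q) / (γ * q)) / q) ∧
      stab γ q ((-v + u₀) / q) + stab γ q (-u₀ / q) ≤
        9 / 16 * v ^ 2 * (min q ((1 - q) / (γ * q)) / q) := by
  have hγ0 : 0 < γ := by linarith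
  rcases le_or_gt q ((1 - q) / (γ * q)) with hc | hc
  · rw [min_eq_left hc, div_self h0.ne', mul_one]
    have hlog : ∀ u : ℝ, -1 < u → stab γ q (u / q) ≤ u - log (1 + u) := by
      intro u hu
      have := stab_le_log hγ0.le h0 h1 (z := u / q) (by rwa [div_mul_cancel₀ _ h0.ne'])
      rwa [div_mul_cancel₀ _ h0.ne'] at this
    have hneg : ∀ a : ℝ, 0 ≤ a → a ≤ 6 / 11 →
        stab γ q (-a / q) ≤ a ^ 2 / 2 + a ^ 3 / 3 + 11 / 20 * a ^ 4 := by
      intro a ha ha'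
      have := hlog (-a) (by linarith)
      have h3 := neg_log_one_sub_le ha ha'
      rw [← sub_eq_add_neg] at this
      linarith
    have hpos : ∀ u : ℝ, 0 ≤ u → stab γ q (u / q) * (2 + u) ≤ u ^ 2 := by
      intro u hu
      have h2 := hlog u (by linarith)
      have h3 := le_log_one_add_of_nonneg hu
      have h4 : stab γ q (u / q) ≤ u - 2 * u / (u + 2) := by linarith
      calc _ ≤ (u - 2 * u / (u + 2)) * (2 + u) := by gcongr
        _ = u ^ 2 := by field_simp; ring
    have hv2 : v ^ 2 ≤ 2 / 3 * v := by nlinarith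
    have hA' : stab γ q (-(3 / 10 * v ^ 2) / q) ≤ 54 / 1000 * v ^ 4 := by
      have h2 := hneg (3 / 10 * v ^ 2) (by positivity) (by nlinarith)
      have h3 : 3 / 10 * v ^ 2 ≤ 2 / 15 := by nlinarith
      have h4 : 0 ≤ 3 / 10 * v ^ 2 := by positivity
      generalize hw : 3 / 10 * v ^ 2 = w at *
      have h5 : 54 / 1000 * v ^ 4 = 6 / 10 * w ^ 2 := by rw [← hw]; ring
      rw [h5]
      nlinarith [mul_nonneg (sq_nonneg w) (sub_nonneg.2 h3),
        mul_nonneg (mul_nonneg (sq_nonneg w) (sub_nonneg.2 h3)) h4]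
    -- The bound `u - log (1 + u)` begins `u ^ 2 / 2 - u ^ 3 / 3`. At `u = ±v + c * v ^ 2` the cubic
    -- terms cancel for `c = 1 / 3`; the value `3 / 10` is near enough, and both directions stay
    -- below `9 / 16 * v ^ 2`.
    refine ⟨3 / 10 * v ^ 2, ?_, ?_⟩
    · have h2 := hpos (v + 3 / 10 * v ^ 2) (by positivity)
      suffices h : stab γ q ((v + 3 / 10 * v ^ 2) / q) ≤ 9 / 16 * v ^ 2 - 54 / 1000 * v ^ 4 by
        linarith
      have h3 : 0 < 2 + (v + 3 / 10 * v ^ 2) := by positivity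
      refine le_of_mul_le_mul_right (h2.trans ?_) h3
      have h4 : (1 + 3 / 10 * v) ^ 2 ≤
          (9 / 16 - 54 / 1000 * v ^ 2) * (2 + (v + 3 / 10 * v ^ 2)) := by
        nlinarith [mul_nonneg hv0 (sub_nonneg.2 hv), mul_nonneg (sq_nonneg v) (sub_nonneg.2 hv),
          mul_nonneg (mul_nonneg (sq_nonneg v) hv0) (sub_nonneg.2 hv)]
      linarith [mul_le_mul_of_nonneg_left h4 (sq_nonneg v)]
    · have e : -v + 3 / 10 * v ^ 2 = -(v - 3 / 10 * v ^ 2) := by ring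
      have h2 := hneg (v - 3 / 10 * v ^ 2) (by nlinarith) (by nlinarith)
      rw [e]
      have h4 : (1 - 3 / 10 * v) ^ 2 / 2 + v * (1 - 3 / 10 * v) ^ 3 / 3 +
          11 / 20 * v ^ 2 * (1 - 3 / 10 * v) ^ 4 + 54 / 1000 * v ^ 2 ≤ 9 / 16 := by
        -- The polynomial inequality of degree six is certified in the Bernstein basis of `[0, 2 /
        -- 3]`.
        have hb : ∀ i j : ℕ, 0 ≤ v ^ i * (2 / 3 - v) ^ j := fun i j =>
          mul_nonneg (pow_nonneg hv0 i) (pow_nonneg (sub_nonneg.2 hv) j)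
        linarith [hb 0 6, hb 1 5, hb 2 4, hb 3 3, hb 4 2, hb 5 1, hb 6 0]
      linarith [mul_le_mul_of_nonneg_left h4 (sq_nonneg v)]
  · rw [min_eq_right hc.le]
    -- In this regime the entropy part dominates. The natural variable is `v / (q * γ)`, which is no
    -- larger than `v`.
    have hqγ : 1 ≤ q * γ := by
      rw [div_lt_iff₀ (by positivity)] at hc
      rcases le_or_gt (1 / 2) q with h | h
      · nlinarith
      · nlinarith
    set x := v / (q * γ) with hx
    have hx0 : 0 ≤ x := by positivity
    have hx1 : x ≤ 2 / 3 := (div_le_self hv0 hqγ).trans hv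
    have hvx : v = x * (q * γ) := by rw [hx]; field_simp
    have hR : 9 / 16 * v ^ 2 * ((1 - q) / (γ * q) / q) = γ * (1 - q) * (9 / 16 * x ^ 2) := by
      rw [hvx]; field_simp
    have hE : ∀ y : ℝ, |y| ≤ 1 → stab γ q (y * (q * γ) / q) ≤
        γ * (1 - q) * (y ^ 2 / 2 + y ^ 3 / 6 + 5 / 96 * y ^ 4) := by
      intro y hy
      have h2 := stab_le_exp hγ0 h0 h1 (y * (q * γ) / q)
      rw [show y * (q * γ) / q / γ = y by field_simp] at h2
      exact h2.trans (mul_le_mul_of_nonneg_left (exp_sub_le hy) (by nlinarith))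
    have hc0 : 0 ≤ γ * (1 - q) := by nlinarith
    have hx2 : x ^ 2 ≤ 2 / 3 * x := by nlinarith
    have hb : ∀ i j : ℕ, 0 ≤ x ^ i * (2 / 3 - x) ^ j := fun i j =>
      mul_nonneg (pow_nonneg hx0 i) (pow_nonneg (sub_nonneg.2 hx1) j)
    have hsmall : (3 / 20 * x ^ 2) ^ 2 / 2 + (3 / 20 * x ^ 2) ^ 3 / 6 +
        5 / 96 * (3 / 20 * x ^ 2) ^ 4 ≤ 12 / 1000 * x ^ 4 := by
      have h3 : 3 / 20 * x ^ 2 ≤ 1 / 15 := by nlinarith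
      have h4 : 0 ≤ 3 / 20 * x ^ 2 := by positivity
      generalize hw : 3 / 20 * x ^ 2 = w at *
      have h5 : 12 / 1000 * x ^ 4 = 12 / 1000 * (400 / 9) * w ^ 2 := by rw [← hw]; ring
      rw [h5]
      nlinarith [mul_nonneg (sq_nonneg w) (sub_nonneg.2 h3),
        mul_nonneg (mul_nonneg (sq_nonneg w) (sub_nonneg.2 h3)) h4]
    have hA' := hE (3 / 20 * x ^ 2) (by rw [abs_of_nonneg (by positivity)]; nlinarith)
    -- The expansion is now `x ^ 2 / 2 + x ^ 3 / 6`, so the cancelling shift has the opposite sign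
    -- and size about `x ^ 2 / 6`.
    refine ⟨-(3 / 20 * x ^ 2 * (q * γ)), ?_, ?_⟩
    · have h2 := hE (x - 3 / 20 * x ^ 2) (by rw [abs_le]; constructor <;> nlinarith)
      rw [neg_neg, show v + -(3 / 20 * x ^ 2 * (q * γ)) = (x - 3 / 20 * x ^ 2) * (q * γ) by
        rw [hvx]; ring, hR]
      refine (add_le_add h2 hA').trans ?_
      rw [← mul_add]
      refine mul_le_mul_of_nonneg_left ?_ hc0
      have h4 : (1 - 3 / 20 * x) ^ 2 / 2 + x * (1 - 3 / 20 * x) ^ 3 / 6 +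
          5 / 96 * x ^ 2 * (1 - 3 / 20 * x) ^ 4 + 12 / 1000 * x ^ 2 ≤ 9 / 16 := by
        linarith [hb 0 6, hb 1 5, hb 2 4, hb 3 3, hb 4 2, hb 5 1, hb 6 0]
      linarith [mul_le_mul_of_nonneg_left h4 (sq_nonneg x)]
    · have h2 := hE (-(x + 3 / 20 * x ^ 2))
        (by rw [abs_neg, abs_le]; constructor <;> nlinarith)
      rw [neg_neg, show -v + -(3 / 20 * x ^ 2 * (q * γ)) = -(x + 3 / 20 * x ^ 2) * (q * γ) by
        rw [hvx]; ring, hR]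
      refine (add_le_add h2 hA').trans ?_
      rw [← mul_add]
      refine mul_le_mul_of_nonneg_left ?_ hc0
      have h4 : (1 + 3 / 20 * x) ^ 2 / 2 - x * (1 + 3 / 20 * x) ^ 3 / 6 +
          5 / 96 * x ^ 2 * (1 + 3 / 20 * x) ^ 4 + 12 / 1000 * x ^ 2 ≤ 9 / 16 := by
        linarith [hb 0 6, hb 1 5, hb 2 4, hb 3 3, hb 4 2, hb 5 1, hb 6 0]
      linarith [mul_le_mul_of_nonneg_left h4 (sq_nonneg x)]

end

end StabilityFunction

end

/-! ### Geometry of cells and connectivity through neighbours. -/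

noncomputable section

namespace PMGame

open Set Matrix Topology

variable {k d : ℕ} {S : Type*} {𝒢 : PMGame k d S}

theorem mem_cell_iff {a : Fin k} {u : Fin d → ℝ} :
    u ∈ 𝒢.cell a ↔ u ∈ stdSimplex ℝ (Fin d) ∧ ∀ b, 𝒢.loss a ⬝ᵥ u ≤ 𝒢.loss b ⬝ᵥ u := by
  have h : ∀ b, ∑ x, (𝒢.loss a x - 𝒢.loss b x) * u x = 𝒢.loss a ⬝ᵥ u - 𝒢.loss b ⬝ᵥ u := fun b => by
    simp [dotProduct, sub_mul]
  simp [cell, h]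

theorem convex_cell (a : Fin k) : Convex ℝ (𝒢.cell a) := by
  intro u hu v hv s t hs ht hst
  rw [mem_cell_iff] at hu hv ⊢
  refine ⟨convex_stdSimplex ℝ _ hu.1 hv.1 hs ht hst, fun b => ?_⟩
  simp only [dotProduct_add, dotProduct_smul, smul_eq_mul]
  exact add_le_add (mul_le_mul_of_nonneg_left (hu.2 b) hs) (mul_le_mul_of_nonneg_left (hv.2 b) ht)

theorem continuous_dotProduct_right (w : Fin d → ℝ) : Continuous fun u : Fin d → ℝ => w ⬝ᵥ u := by
  unfold dotProduct
  fun_prop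

theorem isClosed_cell (a : Fin k) : IsClosed (𝒢.cell a) := by
  have : 𝒢.cell a = stdSimplex ℝ (Fin d) ∩ ⋂ b, {u | 𝒢.loss a ⬝ᵥ u ≤ 𝒢.loss b ⬝ᵥ u} := by
    ext u
    simp [mem_cell_iff]
  rw [this]
  exact (isClosed_stdSimplex ℝ (Fin d)).inter (isClosed_iInter fun b =>
    isClosed_le (continuous_dotProduct_right _) (continuous_dotProduct_right _))

theorem exists_mem_cell [Nonempty (Fin k)] {z : Fin d → ℝ} (hz : z ∈ stdSimplex ℝ (Fin d)) :
    ∃ a, z ∈ 𝒢.cell a := by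
  obtain ⟨a, ha⟩ := Finite.exists_min fun a => 𝒢.loss a ⬝ᵥ z
  exact ⟨a, mem_cell_iff.2 ⟨hz, ha⟩⟩

/-- The coordinate sum is `1` on `I` and vanishes on its direction, so a point of `I` adds exactly
one dimension. Affine dimension counts thus become counts for linear subspaces. -/
theorem finrank_span_eq_affDim_add_one {I : Set (Fin d → ℝ)} (hI : I.Nonempty)
    (hs : I ⊆ stdSimplex ℝ (Fin d)) :
    Module.finrank ℝ (Submodule.span ℝ I) = affDim I + 1 := by
  obtain ⟨i, hi⟩ := hI
  have h1 : ∀ u ∈ I, dotProductEquiv ℝ (Fin d) 1 u = 1 := fun u hu => by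
    simpa [dotProduct] using (hs hu).2
  have hi0 : i ≠ 0 := by
    rintro rfl
    simpa using h1 0 hi
  have hker : vectorSpan ℝ I ≤ LinearMap.ker (dotProductEquiv ℝ (Fin d) 1) := by
    rw [vectorSpan_eq_span_vsub_set_right ℝ hi, Submodule.span_le]
    rintro _ ⟨u, hu, rfl⟩
    simp only [vsub_eq_sub, SetLike.mem_coe, LinearMap.mem_ker, map_sub, h1 u hu, h1 i hi, sub_self]
  have hsup : Submodule.span ℝ I = vectorSpan ℝ I ⊔ Submodule.span ℝ {i} := by
    refine le_antisymm (Submodule.span_le.2 fun u hu => ?_) (sup_le ?_ ?_)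
    · rw [← sub_add_cancel u i]
      exact Submodule.add_mem_sup (vsub_mem_vectorSpan ℝ hu hi)
        (Submodule.mem_span_singleton_self i)
    · rw [vectorSpan_eq_span_vsub_set_right ℝ hi, Submodule.span_le]
      rintro _ ⟨u, hu, rfl⟩
      exact Submodule.sub_mem _ (Submodule.subset_span hu) (Submodule.subset_span hi)
    · exact Submodule.span_mono (by simpa using hi)
  have hinf : vectorSpan ℝ I ⊓ Submodule.span ℝ {i} = ⊥ := by
    rw [eq_bot_iff]
    rintro u ⟨hu, hu'⟩
    obtain ⟨c, rfl⟩ := Submodule.mem_span_singleton.1 hu'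
    have := hker hu
    rw [LinearMap.mem_ker, map_smul, h1 i hi, smul_eq_mul, mul_one] at this
    simp [this]
  have := Submodule.finrank_sup_add_finrank_inf_eq (vectorSpan ℝ I) (Submodule.span ℝ {i})
  rw [hinf, ← hsup, finrank_span_singleton hi0, finrank_bot, add_zero] at this
  rw [this, affDim, direction_affineSpan]

theorem cell_subset_stdSimplex (a : Fin k) : 𝒢.cell a ⊆ stdSimplex ℝ (Fin d) := fun _ h => h.1

theorem NonDegenerate.isPareto (h : 𝒢.NonDegenerate) {a : Fin k} (ha : (𝒢.cell a).Nonempty) :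
    𝒢.IsPareto a := by
  refine ⟨ha, le_antisymm ?_ (not_lt.1 fun h' => h a ⟨ha, h'⟩)⟩
  rw [← finrank_span_eq_affDim_add_one ha (cell_subset_stdSimplex a)]
  simpa using Submodule.finrank_le (Submodule.span ℝ (𝒢.cell a))

theorem IsPareto.span_cell {a : Fin k} (ha : 𝒢.IsPareto a) :
    Submodule.span ℝ (𝒢.cell a) = ⊤ := by
  refine Submodule.eq_top_of_finrank_eq ?_
  rw [finrank_span_eq_affDim_add_one ha.1 (cell_subset_stdSimplex a), ha.2]
  simp

/-- If a linear functional is nonnegative on the cell of a Pareto optimal action and not zero, then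
it is positive somewhere on the cell. -/
theorem IsPareto.exists_pos {a : Fin k} (ha : 𝒢.IsPareto a) {w : Fin d → ℝ} (hw : w ≠ 0)
    (h : ∀ u ∈ 𝒢.cell a, 0 ≤ w ⬝ᵥ u) : ∃ u ∈ 𝒢.cell a, 0 < w ⬝ᵥ u := by
  by_contra! hn
  have h1 : Submodule.span ℝ (𝒢.cell a) ≤ LinearMap.ker (dotProductEquiv ℝ (Fin d) w) :=
    Submodule.span_le.2 fun u hu => by simpa using le_antisymm (hn u hu) (h u hu)
  rw [ha.span_cell, top_le_iff, LinearMap.ker_eq_top] at h1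
  exact hw ((map_eq_zero_iff _ (LinearEquiv.injective _)).1 h1)

/-- The relative interior of the cell of a Pareto optimal action contains a point at which all
outcomes are possible and the action is the only optimal one. -/
theorem IsPareto.exists_interior (hdup : 𝒢.HasNoDuplicates) {a : Fin k} (ha : 𝒢.IsPareto a) :
    ∃ u ∈ 𝒢.cell a, (∀ x, 0 < u x) ∧ ∀ b, b ≠ a → 𝒢.loss a ⬝ᵥ u < 𝒢.loss b ⬝ᵥ u := by
  have hw : ∀ i : Fin k ⊕ Fin d, ∃ u ∈ 𝒢.cell a,
      i.elim (fun b => b ≠ a → 𝒢.loss a ⬝ᵥ u < 𝒢.loss b ⬝ᵥ u) (fun x => 0 < u x) := by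
    rintro (b | x)
    · by_cases hb : b = a
      · obtain ⟨u, hu⟩ := ha.1
        exact ⟨u, hu, fun h => absurd hb h⟩
      · obtain ⟨u, hu, hp⟩ := ha.exists_pos (w := 𝒢.loss b - 𝒢.loss a)
          (sub_ne_zero.2 (hdup b a hb)) fun u hu => by
            rw [sub_dotProduct, sub_nonneg]
            exact (mem_cell_iff.1 hu).2 b
        rw [sub_dotProduct, sub_pos] at hp
        exact ⟨u, hu, fun _ => hp⟩
    · obtain ⟨u, hu, hp⟩ := ha.exists_pos (w := Pi.single x 1)
        (by simp) fun u hu => by simpa using hu.1.1 x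
      exact ⟨u, hu, by simpa using hp⟩
  choose v hv hvp using hw
  obtain ⟨u0, hu0⟩ := ha.1
  have hd : 0 < d := by
    rcases Nat.eq_zero_or_pos d with rfl | h
    · simpa using hu0.1.2
    · exact h
  set c : ℝ := (Fintype.card (Fin k ⊕ Fin d) : ℝ)⁻¹ with hc
  have hc0 : 0 < c := by
    rw [hc]
    have : Nonempty (Fin k ⊕ Fin d) := ⟨Sum.inl a⟩
    exact inv_pos.2 (by exact_mod_cast Fintype.card_pos)
  have hmem : ∑ i, c • v i ∈ 𝒢.cell a := by
    refine (convex_cell a).sum_mem (fun _ _ => hc0.le) ?_ fun i _ => hv i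
    rw [Finset.sum_const, hc, nsmul_eq_mul, Finset.card_univ,
      mul_inv_cancel₀ (inv_pos.1 (hc ▸ hc0)).ne']
  refine ⟨_, hmem, fun x => ?_, fun b hb => ?_⟩
  · simp only [Finset.sum_apply, Pi.smul_apply, smul_eq_mul]
    exact Finset.sum_pos' (fun i _ => mul_nonneg hc0.le ((hv i).1.1 x))
      ⟨Sum.inr x, Finset.mem_univ _, mul_pos hc0 (hvp (Sum.inr x))⟩
  · simp only [dotProduct_sum, dotProduct_smul, smul_eq_mul]
    exact Finset.sum_lt_sum
      (fun i _ => mul_le_mul_of_nonneg_left ((mem_cell_iff.1 (hv i)).2 b) hc0.le)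
      ⟨Sum.inl b, Finset.mem_univ _, mul_lt_mul_of_pos_left (hvp (Sum.inl b) hb) hc0⟩

theorem Neighbors.symm {a b : Fin k} (h : 𝒢.Neighbors a b) : 𝒢.Neighbors b a :=
  ⟨h.2.1, h.1, by rw [inter_comm]; exact h.2.2.1, by rw [inter_comm]; exact h.2.2.2⟩

theorem Neighbors.ne {a b : Fin k} (h : 𝒢.Neighbors a b) : a ≠ b := by
  rintro rfl
  have := h.2.2.2
  rw [inter_self] at this
  have := h.1.2
  omega

/-- If the cells of two different Pareto optimal actions meet and the actions are not neighbours,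
then the intersection of the cells has codimension at least two. -/
theorem finrank_span_inter_lt (hdup : 𝒢.HasNoDuplicates) {a b : Fin k} (ha : 𝒢.IsPareto a)
    (hb : 𝒢.IsPareto b) (hab : a ≠ b) (hne : (𝒢.cell a ∩ 𝒢.cell b).Nonempty)
    (hn : ¬ 𝒢.Neighbors a b) :
    Module.finrank ℝ (Submodule.span ℝ (𝒢.cell a ∩ 𝒢.cell b)) + 1 < d := by
  have h1 := finrank_span_eq_affDim_add_one hne fun u hu => hu.1.1
  have h2 : affDim (𝒢.cell a ∩ 𝒢.cell b) + 2 ≠ d := fun h => hn ⟨ha, hb, hne, h⟩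
  have h3 : Submodule.span ℝ (𝒢.cell a ∩ 𝒢.cell b) < ⊤ := by
    rw [lt_top_iff_ne_top]
    intro h
    have h4 : Submodule.span ℝ (𝒢.cell a ∩ 𝒢.cell b) ≤
        LinearMap.ker (dotProductEquiv ℝ (Fin d) (𝒢.loss a - 𝒢.loss b)) :=
      Submodule.span_le.2 fun u hu => by
        simpa [sub_eq_zero] using
          le_antisymm ((mem_cell_iff.1 hu.1).2 b) ((mem_cell_iff.1 hu.2).2 a)
    rw [h, top_le_iff, LinearMap.ker_eq_top] at h4
    exact hdup a b hab (sub_eq_zero.1 ((map_eq_zero_iff _ (LinearEquiv.injective _)).1 h4))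
  have h5 := Submodule.finrank_lt h3.ne
  rw [Module.finrank_fin_fun] at h5
  omega

/-- On a connected set of outcome distributions, if actions inside and outside `P` are optimal
somewhere, then at some point an action inside and an action outside `P` are both optimal. -/
theorem exists_mem_cell_inter_of_isPreconnected [Nonempty (Fin k)] {s : Set (Fin d → ℝ)}
    (hs : s ⊆ stdSimplex ℝ (Fin d)) (hc : IsPreconnected s) (P : Set (Fin k)) {u v : Fin d → ℝ}
    (hu : u ∈ s) (hv : v ∈ s) {a b : Fin k} (ha : a ∈ P) (hau : u ∈ 𝒢.cell a) (hb : b ∉ P)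
    (hbv : v ∈ 𝒢.cell b) :
    ∃ z ∈ s, (∃ a ∈ P, z ∈ 𝒢.cell a) ∧ ∃ b ∉ P, z ∈ 𝒢.cell b := by
  have := isPreconnected_closed_iff.1 hc (⋃ a ∈ P, 𝒢.cell a) (⋃ b ∈ Pᶜ, 𝒢.cell b)
    (P.toFinite.isClosed_biUnion fun a _ => isClosed_cell a)
    (Pᶜ.toFinite.isClosed_biUnion fun a _ => isClosed_cell a)
    (fun z hz => by
      obtain ⟨c, hcz⟩ := exists_mem_cell (𝒢 := 𝒢) (hs hz)
      by_cases h : c ∈ P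
      · exact Or.inl (mem_biUnion h hcz)
      · exact Or.inr (mem_biUnion (show c ∈ Pᶜ from h) hcz))
    ⟨u, hu, mem_biUnion ha hau⟩ ⟨v, hv, mem_biUnion (show b ∈ Pᶜ from hb) hbv⟩
  obtain ⟨z, hz, h1, h2⟩ := this
  exact ⟨z, hz, by simpa using h1, by simpa using h2⟩

theorem exists_nhds_cell_imp (z : Fin d → ℝ) :
    ∃ r > 0, ∀ v ∈ Metric.ball z r, ∀ a, v ∈ 𝒢.cell a → z ∈ 𝒢.cell a := by
  have h : ∀ᶠ v in 𝓝 z, ∀ a, v ∈ 𝒢.cell a → z ∈ 𝒢.cell a := by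
    rw [Filter.eventually_all]
    intro a
    by_cases ha : z ∈ 𝒢.cell a
    · exact Filter.Eventually.of_forall fun _ _ => ha
    · filter_upwards [(isClosed_cell a).isOpen_compl.mem_nhds ha] with v hv hv'
      exact absurd hv' hv
  obtain ⟨r, hr, h⟩ := Metric.eventually_nhds_iff_ball.1 h
  exact ⟨r, hr, h⟩

/-- If at `z` both an action inside and an action outside `P` are optimal, then two such actions
are neighbours. -/
theorem exists_neighbors_of_mem_cell (hdup : 𝒢.HasNoDuplicates) (hnd : 𝒢.NonDegenerate)
    {z : Fin d → ℝ} (P : Set (Fin k)) {a₀ b₀ : Fin k} (ha₀ : a₀ ∈ P) (hza : z ∈ 𝒢.cell a₀)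
    (hb₀ : b₀ ∉ P) (hzb : z ∈ 𝒢.cell b₀) :
    ∃ a ∈ P, ∃ b ∉ P, z ∈ 𝒢.cell a ∧ z ∈ 𝒢.cell b ∧ 𝒢.Neighbors a b := by
  by_contra! hcon
  have : Nonempty (Fin k) := ⟨a₀⟩
  have hzS := hza.1
  obtain ⟨r, hr, hball⟩ := exists_nhds_cell_imp (𝒢 := 𝒢) z
  have hnear : ∀ c, z ∈ 𝒢.cell c → ∃ y ∈ 𝒢.cell c, y ∈ Metric.ball z r ∧ (∀ x, 0 < y x) ∧
      ∀ b, b ≠ c → 𝒢.loss c ⬝ᵥ y < 𝒢.loss b ⬝ᵥ y := by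
    intro c hc
    obtain ⟨u, hu, hpos, hstrict⟩ := (hnd.isPareto ⟨z, hc⟩).exists_interior hdup
    have hcont : Continuous fun t : ℝ => (1 - t) • z + t • u := by fun_prop
    have h0 : (fun t : ℝ => (1 - t) • z + t • u) ⁻¹' Metric.ball z r ∈ 𝓝 (0 : ℝ) :=
      hcont.continuousAt.preimage_mem_nhds (by simpa using Metric.ball_mem_nhds z hr)
    obtain ⟨e, he, hsub⟩ := Metric.mem_nhds_iff.1 h0
    set t := min (e / 2) 1
    have ht0 : 0 < t := by positivity
    have ht1 : t ≤ 1 := min_le_right _ _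
    have hte : t < e := (min_le_left _ _).trans_lt (by linarith)
    refine ⟨(1 - t) • z + t • u, convex_cell c hc hu (by linarith) ht0.le (by ring), hsub ?_, ?_, ?_⟩
    · simpa [abs_of_pos ht0] using hte
    · intro x
      simp only [Pi.add_apply, Pi.smul_apply, smul_eq_mul]
      exact add_pos_of_nonneg_of_pos (mul_nonneg (by linarith) (hzS.1 x)) (mul_pos ht0 (hpos x))
    · intro b hb
      simp only [dotProduct_add, dotProduct_smul, smul_eq_mul]
      exact add_lt_add_of_le_of_lt
        (mul_le_mul_of_nonneg_left ((mem_cell_iff.1 hc).2 b) (by linarith))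
        (mul_lt_mul_of_pos_left (hstrict b hb) ht0)
  obtain ⟨x₀, hx₀, hx₀r, -, hx₀s⟩ := hnear a₀ hza
  obtain ⟨y₀, hy₀, hy₀r, hy₀p, hy₀s⟩ := hnear b₀ hzb
  -- points near `y₀` lie in one of finitely many proper subspaces
  let W : Fin k × Fin k → Submodule ℝ (Fin d → ℝ) := fun i =>
    Submodule.span ℝ {x₀} ⊔ Submodule.span ℝ (𝒢.cell i.1 ∩ 𝒢.cell i.2)
  let I : Set (Fin k × Fin k) := {i | W i ≠ ⊤}
  have hnull : MeasureTheory.volume (⋃ i ∈ I, (W i : Set (Fin d → ℝ))) = 0 := by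
    rw [MeasureTheory.measure_biUnion_null_iff I.to_countable]
    exact fun i hi => MeasureTheory.Measure.addHaar_submodule _ _ hi
  have hsum0 : ∑ x, y₀ x = 1 := hy₀.1.2
  have hcS : Continuous fun y : Fin d → ℝ => ∑ x, y x := by fun_prop
  have hnorm : ContinuousAt (fun y : Fin d → ℝ => (∑ x, y x)⁻¹ • y) y₀ := by
    refine ContinuousAt.smul (hcS.continuousAt.inv₀ ?_) continuousAt_id
    rw [hsum0]
    exact one_ne_zero
  -- Project from `x₀`: the segment from `x₀` to the normalization of `y` passes a point where a
  -- cell inside `P` meets one outside. Without neighbours this intersection has codimension at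
  -- least two, so together with `x₀` it spans a proper subspace, and that subspace contains `y`. A
  -- neighbourhood of `y₀` would then be a null set.
  have hev : ∀ᶠ y in 𝓝 y₀, y ∈ ⋃ i ∈ I, (W i : Set (Fin d → ℝ)) := by
    have e1 : ∀ᶠ y in 𝓝 y₀, (∑ x, y x)⁻¹ • y ∈ Metric.ball z r :=
      hnorm.preimage_mem_nhds (Metric.isOpen_ball.mem_nhds (by simpa [hsum0] using hy₀r))
    have e2 : ∀ᶠ y in 𝓝 y₀, ∀ x, 0 < y x := by
      rw [Filter.eventually_all]
      exact fun x => (continuous_apply x).continuousAt.eventually (lt_mem_nhds (hy₀p x))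
    have e3 : ∀ᶠ y in 𝓝 y₀, ∀ b, b ≠ b₀ → 𝒢.loss b₀ ⬝ᵥ y < 𝒢.loss b ⬝ᵥ y := by
      rw [Filter.eventually_all]
      intro b
      by_cases hb : b = b₀
      · exact Filter.Eventually.of_forall fun _ h => absurd hb h
      · filter_upwards [(continuous_dotProduct_right _).continuousAt.eventually_lt
          (continuous_dotProduct_right _).continuousAt (hy₀s b hb)] with y hy _ using hy
    have e4 : ∀ᶠ y in 𝓝 y₀, 0 < ∑ x, y x :=
      hcS.continuousAt.eventually (lt_mem_nhds (hsum0 ▸ one_pos : (0 : ℝ) < ∑ x, y₀ x))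
    filter_upwards [e1, e2, e3, e4] with y h1 h2 h3 h4
    set s := ∑ x, y x with hs
    have hsi : 0 < s⁻¹ := inv_pos.2 h4
    have hy'S : s⁻¹ • y ∈ stdSimplex ℝ (Fin d) := by
      refine ⟨fun x => mul_nonneg hsi.le (h2 x).le, ?_⟩
      simp only [Pi.smul_apply, smul_eq_mul, ← Finset.mul_sum]
      rw [← hs, inv_mul_cancel₀ h4.ne']
    have hy'c : s⁻¹ • y ∈ 𝒢.cell b₀ := by
      refine mem_cell_iff.2 ⟨hy'S, fun b => ?_⟩
      rcases eq_or_ne b b₀ with rfl | hb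
      · rfl
      · simp only [dotProduct_smul, smul_eq_mul]
        exact mul_le_mul_of_nonneg_left (h3 b hb).le hsi.le
    have hsegS : segment ℝ x₀ (s⁻¹ • y) ⊆ stdSimplex ℝ (Fin d) :=
      (convex_stdSimplex ℝ _).segment_subset hx₀.1 hy'S
    obtain ⟨v, hv, ⟨a, haP, hav⟩, b, hbP, hbv⟩ :=
      exists_mem_cell_inter_of_isPreconnected (𝒢 := 𝒢) hsegS
        (convex_segment _ _).isPreconnected P (left_mem_segment ℝ _ _) (right_mem_segment ℝ _ _)
        ha₀ hx₀ hb₀ hy'c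
    have hvr : v ∈ Metric.ball z r := (convex_ball z r).segment_subset hx₀r h1 hv
    have hza' := hball v hvr a hav
    have hzb' := hball v hvr b hbv
    have hab : a ≠ b := fun h => hbP (h ▸ haP)
    have hfin := finrank_span_inter_lt hdup (hnd.isPareto ⟨v, hav⟩) (hnd.isPareto ⟨v, hbv⟩) hab
      ⟨v, hav, hbv⟩ (hcon a haP b hbP hza' hzb')
    refine mem_biUnion (x := (a, b)) ?_ ?_
    · intro htop
      have h5 := Submodule.finrank_add_le_finrank_add_finrank (Submodule.span ℝ {x₀})
        (Submodule.span ℝ (𝒢.cell a ∩ 𝒢.cell b))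
      have h6 : Module.finrank ℝ (Submodule.span ℝ {x₀}) ≤ 1 := by
        simpa using finrank_span_le_card (R := ℝ) ({x₀} : Set (Fin d → ℝ))
      change Submodule.span ℝ {x₀} ⊔ Submodule.span ℝ (𝒢.cell a ∩ 𝒢.cell b) = ⊤ at htop
      rw [htop, finrank_top, Module.finrank_fin_fun] at h5
      omega
    · rw [segment_eq_image] at hv
      obtain ⟨t, ht, rfl⟩ := hv
      -- The crossing is not at `x₀` itself, where `a₀ ∈ P` is the only optimal action; hence `y`
      -- can be recovered from the crossing and `x₀`.
      have ht0 : t ≠ 0 := by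
        rintro rfl
        simp only [sub_zero, one_smul, zero_smul, add_zero] at hbv
        have hb : b = a₀ := by
          by_contra hb
          exact absurd ((mem_cell_iff.1 hbv).2 a₀) (not_le.2 (hx₀s b hb))
        exact hbP (hb ▸ ha₀)
      have hyeq : y = (s * t⁻¹) • (-((1 - t) • x₀) + ((1 - t) • x₀ + t • s⁻¹ • y)) := by
        rw [neg_add_cancel_left, smul_smul, smul_smul]
        rw [show s * t⁻¹ * t * s⁻¹ = 1 by field_simp, one_smul]
      rw [SetLike.mem_coe, hyeq]
      refine Submodule.smul_mem _ _ (Submodule.add_mem_sup ?_ ?_)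
      · exact Submodule.neg_mem _ (Submodule.smul_mem _ _ (Submodule.mem_span_singleton_self _))
      · exact Submodule.subset_span ⟨hav, hbv⟩
  exact (MeasureTheory.Measure.measure_pos_of_mem_nhds MeasureTheory.volume hev).ne' hnull

/-- Along a connected set of outcome distributions on which all optimal actions belong to `K`, the
optimal actions are connected by neighbours in `K`. -/
theorem reflTransGen_neighbors (hdup : 𝒢.HasNoDuplicates) (hnd : 𝒢.NonDegenerate)
    {s : Set (Fin d → ℝ)} (hs : s ⊆ stdSimplex ℝ (Fin d)) (hc : IsPreconnected s)
    {K : Set (Fin k)} (hK : ∀ z ∈ s, ∀ c, z ∈ 𝒢.cell c → c ∈ K) {u v : Fin d → ℝ} (hu : u ∈ s)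
    (hv : v ∈ s) {a b : Fin k} (hau : u ∈ 𝒢.cell a) (hbv : v ∈ 𝒢.cell b) :
    Relation.ReflTransGen (fun c c' => 𝒢.Neighbors c c' ∧ c ∈ K ∧ c' ∈ K) a b := by
  have : Nonempty (Fin k) := ⟨a⟩
  by_contra hn
  obtain ⟨z, hz, ⟨a', ha', hza⟩, b', hb', hzb⟩ := exists_mem_cell_inter_of_isPreconnected hs hc
    {c | Relation.ReflTransGen (fun c c' => 𝒢.Neighbors c c' ∧ c ∈ K ∧ c' ∈ K) a c} hu hv
    Relation.ReflTransGen.refl hau hn hbv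
  obtain ⟨c, hcP, c', hcP', hzc, hzc', hN⟩ :=
    exists_neighbors_of_mem_cell hdup hnd _ ha' hza hb' hzb
  exact hcP' (Relation.ReflTransGen.tail hcP ⟨hN, hK z hz c hzc, hK z hz c' hzc'⟩)

end PMGame

end

/-! ### Theorems of the alternative. -/

section Minimax

open Set Matrix

/-- A theorem of the alternative for finitely many convex functions. -/
theorem exists_forall_neg_of_convexOn {E ι : Type*} [AddCommGroup E] [Module ℝ E] [Fintype ι]
    [Nonempty ι] {C : Set E} (hC : Convex ℝ C) {f : ι → E → ℝ} (hf : ∀ i, ConvexOn ℝ C (f i))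
    (h : ∀ c ∈ stdSimplex ℝ ι, ∃ e ∈ C, ∑ i, c i * f i e < 0) : ∃ e ∈ C, ∀ i, f i e < 0 := by
  classical
  obtain ⟨i₀⟩ := ‹Nonempty ι›
  obtain ⟨e₀, he₀, -⟩ := h _ (single_mem_stdSimplex ℝ i₀)
  -- Strict upper bounds form an open convex set in the finite-dimensional space `ι → ℝ`, so `E`
  -- needs no topology. A functional separating it from `0` has nonpositive coefficients, because
  -- `W` is closed under raising coordinates; normalized, its negative contradicts `h`.
  let W : Set (ι → ℝ) := {w | ∃ e ∈ C, ∀ i, f i e < w i}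
  have hWo : IsOpen W := by
    have : W = ⋃ e ∈ C, univ.pi fun i => Ioi (f i e) := by
      ext w
      simp [W]
    rw [this]
    exact isOpen_biUnion fun e _ => isOpen_set_pi finite_univ fun i _ => isOpen_Ioi
  have hWc : Convex ℝ W := by
    rintro w ⟨e, he, hw⟩ w' ⟨e', he', hw'⟩ s t hs ht hst
    refine ⟨s • e + t • e', hC he he' hs ht hst, fun i => ?_⟩
    refine ((hf i).2 he he' hs ht hst).trans_lt ?_
    simp only [Pi.add_apply, Pi.smul_apply, smul_eq_mul]
    rcases hs.eq_or_lt with rfl | hs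
    · have : t = 1 := by linarith
      simpa [this] using hw' i
    · exact add_lt_add_of_lt_of_le (mul_lt_mul_of_pos_left (hw i) hs)
        (mul_le_mul_of_nonneg_left (hw' i).le ht)
  by_contra hcon
  have h0 : (0 : ι → ℝ) ∉ W := fun ⟨e, he, hw⟩ => hcon ⟨e, he, by simpa using hw⟩
  obtain ⟨F, hF⟩ := geometric_hahn_banach_open_point hWc hWo h0
  rw [map_zero] at hF
  have hlin : ∀ w : ι → ℝ, F w = ∑ i, w i * F (Pi.single i 1) := by
    intro w
    conv_lhs => rw [← Finset.univ_sum_single w]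
    rw [map_sum]
    refine Finset.sum_congr rfl fun i _ => ?_
    rw [← smul_eq_mul, ← map_smul, ← Pi.single_smul, smul_eq_mul, mul_one]
  have hneg : ∀ i, F (Pi.single i 1) ≤ 0 := by
    intro i
    by_contra! hi
    set w₀ : ι → ℝ := fun j => f j e₀ + 1
    have hw : ∀ t : ℝ, 0 ≤ t → F w₀ + t * F (Pi.single i 1) < 0 := by
      intro t ht
      rw [← smul_eq_mul, ← map_smul, ← map_add]
      refine hF _ ⟨e₀, he₀, fun j => ?_⟩
      have : 0 ≤ t * (Pi.single i 1 : ι → ℝ) j :=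
        mul_nonneg ht ((single_mem_stdSimplex ℝ i).1 j)
      simp only [Pi.add_apply, Pi.smul_apply, smul_eq_mul, w₀]
      linarith
    have hw0 := hw 0 le_rfl
    have := hw (-F w₀ / F (Pi.single i 1)) (div_nonneg (by linarith) hi.le)
    rw [div_mul_cancel₀ _ hi.ne'] at this
    linarith
  have hle : ∀ e ∈ C, ∑ i, f i e * F (Pi.single i 1) ≤ 0 := by
    intro e he
    rw [← hlin]
    refine le_of_forall_pos_lt_add fun ε hε => ?_
    have hcont : Continuous fun t : ℝ => F fun i => f i e + t := by fun_prop
    obtain ⟨r, hr, hr'⟩ := Metric.continuousAt_iff.1 (hcont.continuousAt (x := 0)) ε hε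
    have h1 := hr' (x := r / 2) (by rw [dist_zero_right, Real.norm_eq_abs, abs_of_pos] <;> linarith)
    have h2 := hF (fun i => f i e + r / 2) ⟨e, he, fun i => by linarith⟩
    rw [Real.dist_eq, abs_lt] at h1
    simp only [add_zero] at h1
    change F (fun i => f i e) < 0 + ε
    linarith [h1.1]
  have hsum : ∑ i, -F (Pi.single i 1) ≠ 0 := by
    intro hs
    have hz := (Finset.sum_eq_zero_iff_of_nonneg fun i _ => neg_nonneg.2 (hneg i)).1 hs
    have := hF (fun i => f i e₀ + 1) ⟨e₀, he₀, fun i => by linarith⟩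
    rw [hlin, Finset.sum_eq_zero] at this
    · exact lt_irrefl _ this
    · intro i hi
      rw [neg_eq_zero.1 (hz i hi), mul_zero]
  have hspos : 0 < ∑ i, -F (Pi.single i 1) :=
    lt_of_le_of_ne (Finset.sum_nonneg fun i _ => neg_nonneg.2 (hneg i)) hsum.symm
  obtain ⟨e, he, hlt⟩ := h (fun i => -F (Pi.single i 1) / ∑ i, -F (Pi.single i 1))
    ⟨fun i => div_nonneg (neg_nonneg.2 (hneg i)) hspos.le, by
      rw [← Finset.sum_div, div_self hsum]⟩
  simp only [div_mul_eq_mul_div] at hlt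
  rw [← Finset.sum_div, div_lt_iff₀ hspos, zero_mul] at hlt
  have := hle e he
  rw [← not_le] at hlt
  refine hlt ?_
  rw [← neg_nonpos, ← Finset.sum_neg_distrib]
  refine le_trans (le_of_eq (Finset.sum_congr rfl fun i _ => ?_)) this
  ring

theorem exists_forall_le_and_le {ι : Type*} [Finite ι] (P N : Set ι) (f g : ι → ℝ)
    (h : ∀ x ∈ P, ∀ y ∈ N, f x ≤ g y) : ∃ s, (∀ x ∈ P, f x ≤ s) ∧ ∀ y ∈ N, s ≤ g y := by
  rcases P.eq_empty_or_nonempty with rfl | hP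
  · rcases N.eq_empty_or_nonempty with rfl | hN
    · exact ⟨0, by simp, by simp⟩
    · obtain ⟨y, -, hy⟩ := exists_min_image N g N.toFinite hN
      exact ⟨g y, by simp, hy⟩
  · obtain ⟨x, hx, hx'⟩ := exists_max_image P f P.toFinite hP
    exact ⟨f x, hx', h x hx⟩

/-- A Lagrange multiplier for one linear constraint. Coordinates with `B x > 0` bound `s` below,
those with `B x < 0` bound it above, and the bounds are compatible by testing `h` on two-point
distributions annihilated by `B`. -/
theorem exists_add_mul_nonneg {d : ℕ} {A B : Fin d → ℝ}
    (h : ∀ u ∈ stdSimplex ℝ (Fin d), B ⬝ᵥ u = 0 → 0 ≤ A ⬝ᵥ u) : ∃ s : ℝ, ∀ x, 0 ≤ A x + s * B x := by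
  have hpair : ∀ x ∈ {x | 0 < B x}, ∀ y ∈ {y | B y < 0}, -A x / B x ≤ A y / -B y := by
    intro x hx y hy
    simp only [mem_ofPred_eq] at hx hy
    have hxy : 0 < B x - B y := by linarith
    have h0 := h ((-B y / (B x - B y)) • Pi.single x 1 + (B x / (B x - B y)) • Pi.single y 1)
      (convex_stdSimplex ℝ _ (single_mem_stdSimplex ℝ x) (single_mem_stdSimplex ℝ y)
        (div_nonneg (by linarith) hxy.le) (div_nonneg hx.le hxy.le)
        (by rw [← add_div, neg_add_eq_sub, div_self hxy.ne']))
      (by simp only [dotProduct_add, dotProduct_smul, dotProduct_single_one, smul_eq_mul]; ring)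
    simp only [dotProduct_add, dotProduct_smul, dotProduct_single_one, smul_eq_mul] at h0
    rw [div_mul_eq_mul_div, div_mul_eq_mul_div, ← add_div, le_div_iff₀ hxy, zero_mul] at h0
    rw [div_le_div_iff₀ hx (by linarith)]
    linarith
  obtain ⟨s, h1, h2⟩ := exists_forall_le_and_le _ _ _ _ hpair
  refine ⟨s, fun x => ?_⟩
  rcases lt_trichotomy (B x) 0 with hx | hx | hx
  · have := h2 x hx
    rw [le_div_iff₀ (by linarith)] at this
    linarith
  · rw [hx, mul_zero, add_zero]
    simpa using h _ (single_mem_stdSimplex ℝ x) (by simpa using hx)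
  · have := h1 x hx
    rw [div_le_iff₀ hx] at this
    linarith

/-- If wherever `c` and `p` agree on the simplex, one of the functionals `L j` is at most `c`, then
a convex combination of the `L j` is bounded by a point on the line through `c` and `p`. -/
theorem exists_comb_le_line {d : ℕ} {ι : Type*} [Fintype ι] [Nonempty ι] (L : ι → Fin d → ℝ)
    (c p : Fin d → ℝ)
    (h : ∀ u ∈ stdSimplex ℝ (Fin d), c ⬝ᵥ u = p ⬝ᵥ u → ∃ j, L j ⬝ᵥ u ≤ c ⬝ᵥ u) :
    ∃ ν ∈ stdSimplex ℝ ι, ∃ s : ℝ, ∀ x, ∑ j, ν j * L j x ≤ (1 - s) * c x + s * p x := by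
  have hC : Convex ℝ {u | u ∈ stdSimplex ℝ (Fin d) ∧ c ⬝ᵥ u = p ⬝ᵥ u} := by
    rintro u ⟨hu, hu'⟩ v ⟨hv, hv'⟩ s t hs ht hst
    refine ⟨convex_stdSimplex ℝ _ hu hv hs ht hst, ?_⟩
    simp only [dotProduct_add, dotProduct_smul, hu', hv']
  obtain ⟨ν, hν, hνu⟩ : ∃ ν ∈ stdSimplex ℝ ι, ∀ u ∈ stdSimplex ℝ (Fin d), c ⬝ᵥ u = p ⬝ᵥ u →
      0 ≤ ∑ j, ν j * ((c - L j) ⬝ᵥ u) := by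
    by_contra! hcon
    obtain ⟨u, ⟨hu, hu'⟩, hj⟩ := exists_forall_neg_of_convexOn hC
      (f := fun j u => dotProductEquiv ℝ (Fin d) (c - L j) u)
      (fun j => LinearMap.convexOn _ hC) fun ν hν => by
        obtain ⟨u, hu, hu', hlt⟩ := hcon ν hν
        exact ⟨u, ⟨hu, hu'⟩, hlt⟩
    obtain ⟨j, hj'⟩ := h u hu hu'
    have := hj j
    rw [dotProductEquiv_apply_apply, sub_dotProduct] at this
    linarith
  obtain ⟨s, hs⟩ := exists_add_mul_nonneg (A := ∑ j, ν j • (c - L j)) (B := p - c)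
    fun u hu hBu => by
      rw [sub_dotProduct, sub_eq_zero] at hBu
      simpa [sum_dotProduct] using hνu u hu hBu.symm
  refine ⟨ν, hν, s, fun x => ?_⟩
  have := hs x
  simp only [Finset.sum_apply, Pi.smul_apply, Pi.sub_apply, smul_eq_mul, mul_sub,
    Finset.sum_sub_distrib, ← Finset.sum_mul, hν.2] at this
  linarith

end Minimax

/-! ### Bounded estimators for neighbouring actions. -/

noncomputable section

namespace PMGame

open Set MeasureTheory

variable {k d : ℕ} {S : Type*} (𝒢 : PMGame k d S)

/-- The largest amount by which the loss of `a` exceeds that of `b`. -/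
def excess (a b : Fin k) : ℝ := ⨆ x, max 0 (𝒢.loss a x - 𝒢.loss b x)

variable {𝒢}

theorem excess_nonneg (a b : Fin k) : 0 ≤ 𝒢.excess a b :=
  Real.iSup_nonneg fun _ => le_max_left _ _

theorem sub_le_excess (a b : Fin k) (x : Fin d) : 𝒢.loss a x - 𝒢.loss b x ≤ 𝒢.excess a b :=
  (le_max_right _ _).trans
    (le_ciSup (f := fun x => max 0 (𝒢.loss a x - 𝒢.loss b x)) (Set.finite_range _).bddAbove x)

theorem excess_le {a b : Fin k} {C : ℝ} (hC : 0 ≤ C) (h : ∀ x, 𝒢.loss a x - 𝒢.loss b x ≤ C) :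
    𝒢.excess a b ≤ C :=
  Real.iSup_le (fun x => max_le hC (h x)) hC

theorem excess_le_one (a b : Fin k) : 𝒢.excess a b ≤ 1 :=
  excess_le zero_le_one fun x => by linarith [(𝒢.loss_mem a x).2, (𝒢.loss_mem b x).1]

theorem ncard_range_feedback_le (a : Fin k) :
    (range (𝒢.feedback a)).ncard ≤ 𝒢.maxSymbols :=
  Finset.le_sup (f := fun a : Fin k => (Set.range (𝒢.feedback a)).ncard) (Finset.mem_univ a)

/-- Loss differences of neighbours can be estimated with bounded functions: the size is controlled
by the number of symbols and the oscillation of the loss difference. -/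
theorem LocallyObservable.exists_bounded (hloc : 𝒢.LocallyObservable) {a b : Fin k}
    (hab : 𝒢.Neighbors a b) :
    ∃ f g : S → ℝ, (∀ x, f (𝒢.feedback a x) + g (𝒢.feedback b x) = 𝒢.loss a x - 𝒢.loss b x) ∧
      (∀ σ, |f σ| ≤ 𝒢.maxSymbols * ((𝒢.excess a b + 𝒢.excess b a) / 2)) ∧
      ∀ σ, |g σ| ≤ 𝒢.maxSymbols * ((𝒢.excess a b + 𝒢.excess b a) / 2) := by
  obtain ⟨w, hw, hw0⟩ := hloc a b hab
  have hsum : ∀ x, w a (𝒢.feedback a x) + w b (𝒢.feedback b x) = 𝒢.loss a x - 𝒢.loss b x := by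
    intro x
    rw [← hw x, Finset.sum_eq_add a b hab.ne (fun c _ hc => hw0 c hc.1 hc.2 _) (by simp) (by simp)]
  -- the levels crossed by some outcome
  let U : Set ℝ := ⋃ x, uIcc (-w b (𝒢.feedback b x)) (w a (𝒢.feedback a x))
  have hosc : 0 ≤ 𝒢.excess a b + 𝒢.excess b a := add_nonneg (excess_nonneg _ _) (excess_nonneg _ _)
  let T : Finset S := (finite_range (𝒢.feedback a)).toFinset
  have hUle : volume U ≤ ENNReal.ofReal (𝒢.maxSymbols * (𝒢.excess a b + 𝒢.excess b a)) := by
    -- Each crossed interval has `w a σ` as an endpoint and a loss difference as its signed length,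
    -- so one interval per symbol of `a` suffices.
    have hsub : U ⊆ ⋃ σ ∈ T, Icc (w a σ - 𝒢.excess a b) (w a σ + 𝒢.excess b a) := by
      refine iUnion_subset fun x => ?_
      refine subset_trans ?_ (subset_biUnion_of_mem (u := fun σ =>
        Icc (w a σ - 𝒢.excess a b) (w a σ + 𝒢.excess b a))
        (show 𝒢.feedback a x ∈ T by simp [T]))
      refine uIcc_subset_Icc ⟨?_, ?_⟩ ⟨?_, ?_⟩
      · linarith [hsum x, sub_le_excess (𝒢 := 𝒢) a b x]
      · linarith [hsum x, sub_le_excess (𝒢 := 𝒢) b a x]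
      · linarith [excess_nonneg (𝒢 := 𝒢) a b]
      · linarith [excess_nonneg (𝒢 := 𝒢) b a]
    refine (measure_mono hsub).trans ((measure_biUnion_finset_le _ _).trans ?_)
    have : ∀ σ, volume (Icc (w a σ - 𝒢.excess a b) (w a σ + 𝒢.excess b a)) =
        ENNReal.ofReal (𝒢.excess a b + 𝒢.excess b a) := fun σ => by
      rw [Real.volume_Icc]
      congr 1
      ring
    simp only [this, Finset.sum_const, nsmul_eq_mul]
    rw [ENNReal.ofReal_mul (by positivity), ENNReal.ofReal_natCast]
    gcongr
    rw [← ncard_eq_toFinset_card _ (finite_range (𝒢.feedback a))]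
    exact ncard_range_feedback_le a
  have hUfin : volume U ≠ ⊤ := ne_top_of_le_ne_top ENNReal.ofReal_ne_top hUle
  have hUr : volume.real U ≤ 𝒢.maxSymbols * (𝒢.excess a b + 𝒢.excess b a) :=
    ENNReal.toReal_le_of_le_ofReal (by positivity) hUle
  -- The map `ψ` collapses the gaps of the line that no outcome crosses. Differences over intervals
  -- inside `U` are kept, so applying `ψ` to `w a` and to `-w b` preserves the estimated loss
  -- difference.
  let ψ : ℝ → ℝ := fun s => volume.real (U ∩ Iic s)
  have hψ0 : ∀ s, 0 ≤ ψ s := fun s => measureReal_nonneg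
  have hψ1 : ∀ s, ψ s ≤ volume.real U := fun s => measureReal_mono inter_subset_left hUfin
  have hψ : ∀ s t, s ≤ t → Icc s t ⊆ U → ψ t = ψ s + (t - s) := by
    intro s t hst hsub
    have : U ∩ Iic t = (U ∩ Iic s) ∪ Ioc s t := by
      ext y
      simp only [mem_inter_iff, mem_Iic, mem_union, mem_Ioc]
      constructor
      · rintro ⟨hy, hyt⟩
        rcases le_or_gt y s with h | h
        · exact Or.inl ⟨hy, h⟩
        · exact Or.inr ⟨h, hyt⟩
      · rintro (⟨hy, h⟩ | ⟨h, hyt⟩)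
        · exact ⟨hy, h.trans hst⟩
        · exact ⟨hsub ⟨h.le, hyt⟩, hyt⟩
    simp only [ψ]
    rw [this, measureReal_union _ measurableSet_Ioc
      (ne_top_of_le_ne_top hUfin (measure_mono inter_subset_left))
      measure_Ioc_lt_top.ne, Real.volume_real_Ioc_of_le hst]
    rw [Set.disjoint_left]
    rintro y ⟨-, hy⟩ ⟨hy', -⟩
    exact absurd hy (not_le.2 hy')
  -- Centring at half the length of `U` saves a factor two; the constant cancels between the two
  -- functions.
  have hbd : ∀ s, |ψ s - volume.real U / 2| ≤
      𝒢.maxSymbols * ((𝒢.excess a b + 𝒢.excess b a) / 2) := by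
    intro s
    have := hψ0 s
    have := hψ1 s
    rw [abs_le]
    constructor <;> linarith
  refine ⟨fun σ => ψ (w a σ) - volume.real U / 2, fun σ => -(ψ (-w b σ) - volume.real U / 2),
    fun x => ?_, fun σ => hbd _, fun σ => by rw [abs_neg]; exact hbd _⟩
  have hx : uIcc (-w b (𝒢.feedback b x)) (w a (𝒢.feedback a x)) ⊆ U :=
    subset_iUnion (fun x => uIcc (-w b (𝒢.feedback b x)) (w a (𝒢.feedback a x))) x
  rcases le_total (-w b (𝒢.feedback b x)) (w a (𝒢.feedback a x)) with h | h
  · rw [uIcc_of_le h] at hx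
    have := hψ _ _ h hx
    linarith [hsum x]
  · rw [uIcc_of_ge h] at hx
    have := hψ _ _ h hx
    linarith [hsum x]

end PMGame

end

/-! ### A covering bound for potentials on weighted graphs. -/

section Charging

open Set MeasureTheory

/-- If an interval is covered by weighted intervals with total weight at least one everywhere, then
its length is at most the weighted sum of the lengths. -/
theorem sub_le_sum_of_cover {ι : Type*} [Fintype ι] {s t : ℝ} (hst : s ≤ t) (c lo hi : ι → ℝ)
    (hc : ∀ i, 0 ≤ c i) (hlh : ∀ i, lo i ≤ hi i)
    (h : ∀ y ∈ Ioc s t, 1 ≤ ∑ i, (Icc (lo i) (hi i)).indicator (fun _ => c i) y) :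
    t - s ≤ ∑ i, c i * (hi i - lo i) := by
  have hint : ∀ i, Integrable ((Icc (lo i) (hi i)).indicator fun _ => c i) :=
    fun i => (integrable_indicator_iff measurableSet_Icc).2
      (integrableOn_const measure_Icc_lt_top.ne)
  calc t - s = ∫ _ in Ioc s t, (1 : ℝ) := by simp [hst]
    _ ≤ ∫ y in Ioc s t, ∑ i, (Icc (lo i) (hi i)).indicator (fun _ => c i) y :=
        setIntegral_mono_on (integrableOn_const measure_Ioc_lt_top.ne)
          (integrable_finsetSum _ fun i _ => hint i).integrableOn measurableSet_Ioc h
    _ ≤ ∫ y, ∑ i, (Icc (lo i) (hi i)).indicator (fun _ => c i) y :=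
        setIntegral_le_integral (integrable_finsetSum _ fun i _ => hint i)
          (ae_of_all _ fun y => Finset.sum_nonneg fun i _ => indicator_nonneg (fun _ _ => hc i) y)
    _ = ∑ i, ∫ y, (Icc (lo i) (hi i)).indicator (fun _ => c i) y :=
        integral_finsetSum _ fun i _ => hint i
    _ = ∑ i, c i * (hi i - lo i) := by
        refine Finset.sum_congr rfl fun i _ => ?_
        rw [integral_indicator measurableSet_Icc, setIntegral_const,
          Real.volume_real_Icc_of_le (hlh i), smul_eq_mul, mul_comm]

/-- A chain from above the level `y` to below it has a link that crosses the level. -/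
theorem exists_crossing {ι : Type*} {R : ι → ι → Prop} {V : ι → ℝ} {y : ℝ} {c p : ι}
    (h : Relation.ReflTransGen R c p) (hne : c ≠ p) (hc : y ≤ V c) (hp : V p ≤ y) :
    ∃ z z', R z z' ∧ y ≤ V z ∧ V z' ≤ y := by
  induction h using Relation.ReflTransGen.head_induction_on with
  | refl => exact absurd rfl hne
  | head hR hch ih =>
    rename_i a a'
    rcases le_or_gt (V a') y with hle | hlt
    · exact ⟨a, a', hR, hc, hle⟩
    · exact ih (fun h => by rw [h] at hlt; exact absurd hp (not_le.2 hlt)) hlt.le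

/-- A bound for potentials on a weighted graph: links of unit weight connect `root` to `b`, and
two long links at the same vertex are bypassed by links of moderate weight. -/
theorem potential_sub_le {ι : Type*} [Fintype ι] {w V : ι → ℝ} {D : ι → ι → ℝ} {N : ι → ι → Prop}
    (hN : ∀ a c, N a c → N c a) {root b : ι} (hw : ∀ a, 1 ≤ w a) (hroot : w root = 1)
    (hD1 : ∀ a c, D a c ≤ 1)
    (hV : ∀ a c, N a c → V a - V c ≤ (D a c + D c a) / 2 * (w a + w c))
    (hpath : Relation.ReflTransGen (fun c c' => N c c' ∧ w c = 1 ∧ w c' = 1) root b)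
    (hconn : ∀ l c p, N l c → N l p → w l = 1 → w c = 1 → w p = 1 → c ≠ p → 1 < D l c + D l p →
      Relation.ReflTransGen (fun z z' => N z z' ∧
        (z ≠ l ∧ w z * (D l c + D l p - 1) ≤ D l c + D l p) ∧
        (z' ≠ l ∧ w z' * (D l c + D l p - 1) ≤ D l c + D l p)) c p) :
    V b - V root ≤ 4 / 3 * (Fintype.card ι - 1) + 1 := by
  classical
  have : Nonempty ι := ⟨b⟩
  have hcard : (1 : ℝ) ≤ Fintype.card ι := by exact_mod_cast Fintype.card_pos
  rcases le_or_gt (V b) (V root) with hle | hlt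
  · linarith
  -- upward and downward reach of a vertex
  let f : ι → ι → ℝ := fun z c =>
    if N z c ∧ w c = 1 then max 0 (min (D z c) (V c - V z)) else 0
  let g : ι → ι → ℝ := fun z c =>
    if N z c ∧ w c = 1 then max 0 (min (D z c) (V z - V c)) else 0
  have hf0 : ∀ z c, 0 ≤ f z c := fun z c => by simp only [f]; split_ifs <;> simp
  have hg0 : ∀ z c, 0 ≤ g z c := fun z c => by simp only [g]; split_ifs <;> simp
  have hf1 : ∀ z c, f z c ≤ 1 := fun z c => by
    simp only [f]; split_ifs
    · exact max_le zero_le_one ((min_le_left _ _).trans (hD1 z c))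
    · exact zero_le_one
  have hg1 : ∀ z c, g z c ≤ 1 := fun z c => by
    simp only [g]; split_ifs
    · exact max_le zero_le_one ((min_le_left _ _).trans (hD1 z c))
    · exact zero_le_one
  have hfpos : ∀ z c, 0 < f z c → N z c ∧ w c = 1 ∧ f z c ≤ D z c ∧ f z c ≤ V c - V z := by
    intro z c h
    simp only [f] at h ⊢
    split_ifs at h ⊢ with hif
    · have h' : 0 < min (D z c) (V c - V z) := by simpa using h
      rw [max_eq_right h'.le]
      exact ⟨hif.1, hif.2, min_le_left _ _, min_le_right _ _⟩
    · exact absurd h (lt_irrefl _)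
  have hgpos : ∀ z c, 0 < g z c → N z c ∧ w c = 1 ∧ g z c ≤ D z c ∧ g z c ≤ V z - V c := by
    intro z c h
    simp only [g] at h ⊢
    split_ifs at h ⊢ with hif
    · have h' : 0 < min (D z c) (V z - V c) := by simpa using h
      rw [max_eq_right h'.le]
      exact ⟨hif.1, hif.2, min_le_left _ _, min_le_right _ _⟩
    · exact absurd h (lt_irrefl _)
  choose cz hcz using fun z => Finite.exists_max (f z)
  choose pz hpz using fun z => Finite.exists_max (g z)
  let α : ι → ℝ := fun z => f z (cz z)
  let β : ι → ℝ := fun z => g z (pz z)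
  have hα0 : ∀ z, 0 ≤ α z := fun z => hf0 _ _
  have hβ0 : ∀ z, 0 ≤ β z := fun z => hg0 _ _
  have hα1 : ∀ z, α z ≤ 1 := fun z => hf1 _ _
  have hβ1 : ∀ z, β z ≤ 1 := fun z => hg1 _ _
  -- Each vertex carries an interval of radius `w z` with density `A z`, and a light one (weight
  -- `1`) also carries its reach with density `B z`. The charge is at most `4 / 3` per vertex: `2 /
  -- 3 + 2 / 3` if light, `2 * w z * A z` if heavy.
  let A : ι → ℝ := fun z => if w z = 1 then 1 / 3 else 2 / 3 / w z
  let B : ι → ℝ := fun z => if w z = 1 then 2 / 3 / max 1 (α z + β z) else 0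
  have hw0 : ∀ z, 0 < w z := fun z => by linarith [hw z]
  have hA0 : ∀ z, 0 ≤ A z := fun z => by
    have := hw0 z
    simp only [A]; split_ifs <;> positivity
  have hB0 : ∀ z, 0 ≤ B z := fun z => by simp only [B]; split_ifs <;> positivity
  have hBh : ∀ z, B z * (α z + β z) ≤ if w z = 1 then 2 / 3 else 0 := by
    intro z
    simp only [B]
    split_ifs
    · rw [div_mul_eq_mul_div, div_le_iff₀ (by positivity)]
      linarith [le_max_right 1 (α z + β z)]
    · simp
  -- Only levels above `V root` need covering, so the lower halves at `root` are cut off and its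
  -- charge drops to `1`.
  let lo : ι ⊕ ι → ℝ := Sum.elim (fun z => if z = root then V z else V z - w z)
    (fun z => if z = root then V z else V z - β z)
  let hi : ι ⊕ ι → ℝ := Sum.elim (fun z => V z + w z) (fun z => V z + α z)
  have hcover := sub_le_sum_of_cover hlt.le (Sum.elim A B) lo hi
    (by rintro (z | z); exacts [hA0 z, hB0 z])
    (by
      rintro (z | z) <;> simp only [lo, hi, Sum.elim_inl, Sum.elim_inr] <;> split_ifs
      · linarith [hw z]
      · linarith [hw z]
      · linarith [hα0 z]
      · linarith [hα0 z, hβ0 z]) ?_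
  · refine hcover.trans ?_
    rw [Fintype.sum_sum_type]
    simp only [Sum.elim_inl, Sum.elim_inr, lo, hi]
    rw [← Finset.sum_add_distrib, ← Finset.add_sum_erase _ _ (Finset.mem_univ root), add_comm]
    refine add_le_add ?_ ?_
    · have hb : ∀ z ∈ Finset.univ.erase root,
          A z * (V z + w z - if z = root then V z else V z - w z) +
          B z * (V z + α z - if z = root then V z else V z - β z) ≤ 4 / 3 := by
        intro z hz
        rw [if_neg (Finset.ne_of_mem_erase hz), if_neg (Finset.ne_of_mem_erase hz)]
        have h1 := hBh z
        have h2 : A z * (2 * w z) ≤ if w z = 1 then 2 / 3 else 4 / 3 := by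
          simp only [A]
          split_ifs with h
          · rw [h]; norm_num
          · have := hw0 z
            field_simp
            norm_num
        split_ifs at h1 h2 <;> linarith
      refine (Finset.sum_le_card_nsmul _ _ _ hb).trans (le_of_eq ?_)
      rw [Finset.card_erase_of_mem (Finset.mem_univ _), nsmul_eq_mul, Finset.card_univ,
        Nat.cast_sub Fintype.card_pos]
      push_cast
      ring
    · rw [if_pos rfl, if_pos rfl]
      have h1 := hBh root
      have h2 := mul_nonneg (hB0 root) (hβ0 root)
      rw [if_pos hroot] at h1
      have h3 : A root = 1 / 3 := if_pos hroot
      rw [h3, hroot]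
      linarith
  · intro y hy
    have hnn : ∀ i : ι ⊕ ι, 0 ≤ (Icc (lo i) (hi i)).indicator (fun _ => Sum.elim A B i) y := by
      intro i
      refine indicator_nonneg (fun _ _ => ?_) y
      rcases i with z | z
      exacts [hA0 z, hB0 z]
    have hJ : ∀ z, |y - V z| ≤ w z →
        (Icc (lo (Sum.inl z)) (hi (Sum.inl z))).indicator (fun _ => Sum.elim A B (Sum.inl z)) y =
          A z := by
      intro z hz
      rw [abs_le] at hz
      refine indicator_of_mem ?_ _
      simp only [lo, hi, Sum.elim_inl]
      split_ifs with h
      · exact ⟨by rw [h]; exact hy.1.le, by linarith⟩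
      · exact ⟨by linarith, by linarith⟩
    have hI : ∀ z, V z - β z ≤ y → y ≤ V z + α z →
        (Icc (lo (Sum.inr z)) (hi (Sum.inr z))).indicator (fun _ => Sum.elim A B (Sum.inr z)) y =
          B z := by
      intro z hz hz'
      refine indicator_of_mem ?_ _
      simp only [lo, hi, Sum.elim_inr]
      split_ifs with h
      · exact ⟨by rw [h]; exact hy.1.le, hz'⟩
      · exact ⟨hz, hz'⟩
    -- a light vertex whose reach contains the level
    obtain ⟨l, hl, hl1, hl2⟩ : ∃ l, w l = 1 ∧ V l - β l ≤ y ∧ y ≤ V l + α l := by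
      obtain ⟨z, c, ⟨hzc, hz, hc⟩, h1, h2⟩ := exists_crossing (V := fun z => -V z) (y := -y) hpath
        (fun h => by rw [h] at hlt; exact lt_irrefl _ hlt) (neg_le_neg hy.1.le) (neg_le_neg hy.2)
      have h1 : V z ≤ y := neg_le_neg_iff.1 h1
      have h2 : y ≤ V c := neg_le_neg_iff.1 h2
      -- Across a light link the gap is at most `D z c + D c z`, so the upward reach of `z` and the
      -- downward reach of `c` together cover it.
      have h3 := hV c z (hN _ _ hzc)
      rw [hz, hc] at h3
      have h4 : min (D z c) (V c - V z) ≤ α z := by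
        refine le_trans ?_ (hcz z c)
        simp only [f]
        rw [if_pos ⟨hzc, hc⟩]
        exact le_max_right _ _
      have h5 : min (D c z) (V c - V z) ≤ β c := by
        refine le_trans ?_ (hpz c z)
        simp only [g]
        rw [if_pos ⟨hN _ _ hzc, hz⟩]
        exact le_max_right _ _
      rcases le_or_gt y (V z + α z) with h | h
      · exact ⟨z, hz, by linarith [hβ0 z], h⟩
      · refine ⟨c, hc, ?_, by linarith [hα0 c]⟩
        rcases min_le_iff.1 h4 with h6 | h6
        · rcases min_le_iff.1 h5 with h7 | h7 <;> linarith
        · linarith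
    have hlJ := hJ l (by rw [hl, abs_le]; constructor <;> linarith [hα1 l, hβ1 l])
    have hlI := hI l hl1 hl2
    have hAl : A l = 1 / 3 := if_pos hl
    have hBl : B l = 2 / 3 / max 1 (α l + β l) := if_pos hl
    rw [Fintype.sum_sum_type]
    have hBsum : B l ≤ ∑ z, (Icc (lo (Sum.inr z)) (hi (Sum.inr z))).indicator
        (fun _ => Sum.elim A B (Sum.inr z)) y := by
      rw [← hlI]
      exact Finset.single_le_sum (f := fun z => (Icc (lo (Sum.inr z)) (hi (Sum.inr z))).indicator
        (fun _ => Sum.elim A B (Sum.inr z)) y) (fun z _ => hnn _) (Finset.mem_univ l)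
    rcases le_or_gt (α l + β l) 1 with hh | hh
    · have hAsum : A l ≤ ∑ z, (Icc (lo (Sum.inl z)) (hi (Sum.inl z))).indicator
          (fun _ => Sum.elim A B (Sum.inl z)) y := by
        rw [← hlJ]
        exact Finset.single_le_sum (f := fun z => (Icc (lo (Sum.inl z)) (hi (Sum.inl z))).indicator
          (fun _ => Sum.elim A B (Sum.inl z)) y) (fun z _ => hnn _) (Finset.mem_univ l)
      rw [max_eq_left hh] at hBl
      linarith
    -- With `s = α l + β l > 1`, the vertex `l` supplies only `1 / 3 + 2 / (3 * s)`. The bypass from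
    -- `cz l` to `pz l` crosses the level near a vertex `v ≠ l` with `w v ≤ s / (s - 1)`, whose
    -- density supplies the missing `2 / 3 - 2 / (3 * s)`.
    · rw [max_eq_right hh.le] at hBl
      have hαp : 0 < α l := by linarith [hβ1 l]
      have hβp : 0 < β l := by linarith [hα1 l]
      obtain ⟨hc1, hc2, hc3, hc4⟩ := hfpos l (cz l) hαp
      obtain ⟨hp1, hp2, hp3, hp4⟩ := hgpos l (pz l) hβp
      have hc3 : α l ≤ D l (cz l) := hc3
      have hc4 : α l ≤ V (cz l) - V l := hc4
      have hp3 : β l ≤ D l (pz l) := hp3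
      have hp4 : β l ≤ V l - V (pz l) := hp4
      have hcp : cz l ≠ pz l := fun h => by rw [h] at hc4; linarith
      obtain ⟨z, z', ⟨hzz, ⟨hz1, hz2⟩, hz1', hz2'⟩, h1, h2⟩ := exists_crossing (V := V) (y := y)
        (hconn l _ _ hc1 hp1 hl hc2 hp2 hcp (by linarith)) hcp (by linarith) (by linarith)
      obtain ⟨v, hvl, hvw, hvy⟩ : ∃ v, v ≠ l ∧
          w v * (D l (cz l) + D l (pz l) - 1) ≤ D l (cz l) + D l (pz l) ∧ |y - V v| ≤ w v := by
        have h3 := hV z z' hzz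
        have h4 : (D z z' + D z' z) / 2 * (w z + w z') ≤ 1 * (w z + w z') := by
          have := hw0 z
          have := hw0 z'
          gcongr
          linarith [hD1 z z', hD1 z' z]
        rcases le_or_gt (V z - y) (w z) with h | h
        · exact ⟨z, hz1, hz2, by rw [abs_le]; constructor <;> linarith [hw0 z]⟩
        · exact ⟨z', hz1', hz2', by rw [abs_le]; constructor <;> linarith [hw0 z']⟩
      have hAsum : A l + A v ≤ ∑ z, (Icc (lo (Sum.inl z)) (hi (Sum.inl z))).indicator
          (fun _ => Sum.elim A B (Sum.inl z)) y := by
        rw [← hlJ, ← hJ v hvy]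
        rw [← Finset.sum_pair (f := fun z => (Icc (lo (Sum.inl z)) (hi (Sum.inl z))).indicator
          (fun _ => Sum.elim A B (Sum.inl z)) y) hvl.symm]
        exact Finset.sum_le_univ_sum_of_nonneg fun z => hnn _
      have hs : 0 < α l + β l := by linarith
      have hvA : 2 / 3 - 2 / 3 / (α l + β l) ≤ A v := by
        have hs2 : α l + β l ≤ 2 := by linarith [hα1 l, hβ1 l]
        simp only [A]
        split_ifs
        · have : 1 / 3 ≤ 2 / 3 / (α l + β l) := by
            rw [le_div_iff₀ hs]
            linarith
          linarith
        · have hwv := hw0 v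
          have : w v * (α l + β l - 1) ≤ α l + β l := by
            nlinarith [hw v]
          rw [show 2 / 3 - 2 / 3 / (α l + β l) = 2 / 3 * (α l + β l - 1) / (α l + β l) by
            field_simp, div_le_div_iff₀ hs hwv]
          linarith
      linarith

end Charging

/-! ### Bypassing an action, and estimators along paths of neighbours. -/

noncomputable section

namespace PMGame

open Set Matrix

variable {k d : ℕ} {S : Type*} {𝒢 : PMGame k d S}

/-- If `l` exceeds both `c` and `p` substantially, then the cells of `c` and `p` are connected
through cells of actions other than `l` whose loss at `lam` is moderate. -/
theorem reflTransGen_bypass (hdup : 𝒢.HasNoDuplicates) (hnd : 𝒢.NonDegenerate)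
    {lam : Fin d → ℝ} (hlam : lam ∈ stdSimplex ℝ (Fin d)) {r M : ℝ}
    (hr : ∀ a, r < 𝒢.loss a ⬝ᵥ lam) {l c p : Fin k} (hcl : c ≠ l) (hpl : p ≠ l) (hcp : c ≠ p)
    (hc : (𝒢.cell c).Nonempty) (hp : (𝒢.cell p).Nonempty)
    (hcM : 𝒢.loss c ⬝ᵥ lam - r ≤ M) (hpM : 𝒢.loss p ⬝ᵥ lam - r ≤ M)
    (hh : 1 < 𝒢.excess l c + 𝒢.excess l p) :
    Relation.ReflTransGen (fun z z' => 𝒢.Neighbors z z' ∧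
      z ∈ {z | z ≠ l ∧ (𝒢.loss z ⬝ᵥ lam - r) * (𝒢.excess l c + 𝒢.excess l p - 1) ≤
        (𝒢.excess l c + 𝒢.excess l p) * M} ∧
      z' ∈ {z | z ≠ l ∧ (𝒢.loss z ⬝ᵥ lam - r) * (𝒢.excess l c + 𝒢.excess l p - 1) ≤
        (𝒢.excess l c + 𝒢.excess l p) * M}) c p := by
  classical
  have : Nonempty (Fin k) := ⟨c⟩
  set h := 𝒢.excess l c + 𝒢.excess l p with hdef
  have hM : 0 < M := by linarith [hr c]
  obtain ⟨uc, huc, -, hucs⟩ := (hnd.isPareto hc).exists_interior hdup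
  obtain ⟨up, hup, -, hups⟩ := (hnd.isPareto hp).exists_interior hdup
  -- The values of `L` are the forbidden actions: those of large regret, and `l`.
  let L : Fin k → Fin k := fun j => if h * M < (𝒢.loss j ⬝ᵥ lam - r) * (h - 1) then j else l
  have hLc : ∀ j, L j ≠ c := by
    intro j
    simp only [L]
    split_ifs with hj
    · rintro rfl
      nlinarith
    · exact hcl.symm
  have hLp : ∀ j, L j ≠ p := by
    intro j
    simp only [L]
    split_ifs with hj
    · rintro rfl
      nlinarith
    · exact hpl.symm
  -- If `c` and `p` tie at some `u` and both beat every forbidden action there, the segments from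
  -- the interiors of their cells to `u` avoid all forbidden cells. Otherwise a mixture of forbidden
  -- losses lies below a point on the line through `c` and `p`, which is refuted.
  by_cases hu : ∃ u ∈ stdSimplex ℝ (Fin d), 𝒢.loss c ⬝ᵥ u = 𝒢.loss p ⬝ᵥ u ∧
      ∀ j, 𝒢.loss c ⬝ᵥ u < 𝒢.loss (L j) ⬝ᵥ u
  · obtain ⟨u, huS, hueq, huj⟩ := hu
    have hseg : ∀ a v, v ∈ 𝒢.cell a → (∀ b, b ≠ a → 𝒢.loss a ⬝ᵥ v < 𝒢.loss b ⬝ᵥ v) →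
        (∀ j, L j ≠ a) → (∀ j, 𝒢.loss a ⬝ᵥ u < 𝒢.loss (L j) ⬝ᵥ u) →
        ∀ z ∈ segment ℝ v u, ∀ e, z ∈ 𝒢.cell e → e ∈ {z | z ≠ l ∧
          (𝒢.loss z ⬝ᵥ lam - r) * (h - 1) ≤ h * M} := by
      rintro a v hv hvs hLa hua z ⟨s, t, hs, ht, hst, rfl⟩ e he
      have hnot : ∀ j, e ≠ L j := by
        rintro j rfl
        have h1 := (mem_cell_iff.1 he).2 a
        have h2 := hvs _ (hLa j)
        have h3 := hua j
        simp only [dotProduct_add, dotProduct_smul, smul_eq_mul] at h1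
        rcases hs.eq_or_lt with rfl | hs
        · have : t = 1 := by linarith
          subst this
          linarith
        · nlinarith
      have hel : ¬ h * M < (𝒢.loss e ⬝ᵥ lam - r) * (h - 1) := fun hlt => by
        refine hnot e ?_
        simp only [L]
        rw [if_pos hlt]
      refine ⟨fun hel' => ?_, not_lt.1 hel⟩
      refine hnot e ?_
      simp only [L]
      rw [if_neg hel, hel']
    have hsub : segment ℝ uc u ∪ segment ℝ up u ⊆ stdSimplex ℝ (Fin d) :=
      union_subset ((convex_stdSimplex ℝ _).segment_subset huc.1 huS)
        ((convex_stdSimplex ℝ _).segment_subset hup.1 huS)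
    refine reflTransGen_neighbors hdup hnd hsub
      (IsPreconnected.union u (right_mem_segment ℝ _ _) (right_mem_segment ℝ _ _)
        (convex_segment _ _).isPreconnected (convex_segment _ _).isPreconnected) ?_
      (Or.inl (left_mem_segment ℝ _ _)) (Or.inr (left_mem_segment ℝ _ _)) huc hup
    rintro z (hz | hz) e he
    · exact hseg c uc huc hucs hLc huj z hz e he
    · exact hseg p up hup hups hLp (fun j => hueq ▸ huj j) z hz e he
  · exfalso
    push Not at hu
    obtain ⟨ν, hν, s, hs⟩ := exists_comb_le_line (fun j => 𝒢.loss (L j)) (𝒢.loss c) (𝒢.loss p)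
      fun u huS hueq => hu u huS hueq
    have hdot : ∀ v ∈ stdSimplex ℝ (Fin d), ∑ j, ν j * (𝒢.loss (L j) ⬝ᵥ v) ≤
        (1 - s) * (𝒢.loss c ⬝ᵥ v) + s * (𝒢.loss p ⬝ᵥ v) := by
      intro v hv
      have h1 : ∑ j, ν j * (𝒢.loss (L j) ⬝ᵥ v) = ∑ x, (∑ j, ν j * 𝒢.loss (L j) x) * v x := by
        simp only [dotProduct, Finset.mul_sum, Finset.sum_mul]
        rw [Finset.sum_comm]
        simp only [mul_assoc]
      have h2 : (1 - s) * (𝒢.loss c ⬝ᵥ v) + s * (𝒢.loss p ⬝ᵥ v) =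
          ∑ x, ((1 - s) * 𝒢.loss c x + s * 𝒢.loss p x) * v x := by
        simp only [dotProduct, Finset.mul_sum, ← Finset.sum_add_distrib]
        exact Finset.sum_congr rfl fun x _ => by ring
      rw [h1, h2]
      exact Finset.sum_le_sum fun x _ => mul_le_mul_of_nonneg_right (hs x) (hv.1 x)
    have hlt : ∀ f g : Fin k → ℝ, (∀ j, f j < g j) → ∑ j, ν j * f j < ∑ j, ν j * g j := by
      intro f g hfg
      obtain ⟨j, hj⟩ : ∃ j, 0 < ν j := by
        by_contra! hcon
        have := hν.2
        rw [Finset.sum_eq_zero fun j _ => le_antisymm (hcon j) (hν.1 j)] at this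
        exact zero_ne_one this
      exact Finset.sum_lt_sum (fun j _ => mul_le_mul_of_nonneg_left (hfg j).le (hν.1 j))
        ⟨j, Finset.mem_univ _, mul_lt_mul_of_pos_left (hfg j) hj⟩
    have hconst : ∀ a : ℝ, ∑ j, ν j * a = a := fun a => by rw [← Finset.sum_mul, hν.2, one_mul]
    have hs0 : 0 < s := by
      have h1 := hlt (fun _ => 𝒢.loss c ⬝ᵥ uc) (fun j => 𝒢.loss (L j) ⬝ᵥ uc) fun j => hucs _ (hLc j)
      rw [hconst] at h1
      have h2 := hdot uc huc.1
      have h3 := hucs p hcp.symm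
      by_contra! hneg
      nlinarith
    have hs1 : s < 1 := by
      have h1 := hlt (fun _ => 𝒢.loss p ⬝ᵥ up) (fun j => 𝒢.loss (L j) ⬝ᵥ up) fun j => hups _ (hLp j)
      rw [hconst] at h1
      have h2 := hdot up hup.1
      have h3 := hups c hcp
      by_contra! hneg
      nlinarith
    let e : Fin k → ℝ := fun j => if h * M < (𝒢.loss j ⬝ᵥ lam - r) * (h - 1) then 1 else 0
    set μ := ∑ j, ν j * e j with hμ
    -- Here `μ` is the mass of the mixture on actions of large regret. At `lam` the mixture has
    -- regret at most `M`, while those actions each exceed `h * M / (h - 1)`; thus `1 < (1 - μ) *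
    -- h`.
    have hμh : μ * h < h - 1 := by
      have h1 := hlt (fun j => e j * (h * M)) (fun j => (𝒢.loss (L j) ⬝ᵥ lam - r) * (h - 1)) ?_
      · have h2 := hdot lam hlam
        simp only [← mul_assoc, ← Finset.sum_mul, mul_sub, Finset.sum_sub_distrib, hν.2, one_mul]
          at h1
        rw [← hμ, mul_one] at h1
        have h3 : ∑ j, ν j * (𝒢.loss (L j) ⬝ᵥ lam) - r ≤ M := by nlinarith
        have h4 : μ * h * M < (h - 1) * M := by nlinarith
        exact lt_of_mul_lt_mul_right h4 hM.le
      · intro j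
        simp only [e, L]
        split_ifs with hj
        · linarith
        · have := mul_pos (sub_pos.2 (hr l)) (sub_pos.2 hh)
          linarith
    have hμ0 : 0 ≤ μ := Finset.sum_nonneg fun j _ => mul_nonneg (hν.1 j) (by
      simp only [e]; split_ifs <;> norm_num)
    have hμ1 : μ < 1 := by nlinarith
    have hl : ∀ x, (1 - μ) * 𝒢.loss l x ≤ (1 - s) * 𝒢.loss c x + s * 𝒢.loss p x := by
      intro x
      refine le_trans ?_ (hs x)
      have : (1 - μ) * 𝒢.loss l x = ∑ j, ν j * ((1 - e j) * 𝒢.loss l x) := by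
        simp only [← mul_assoc, ← Finset.sum_mul, mul_sub, Finset.sum_sub_distrib, hν.2, mul_one]
        rfl
      rw [this]
      refine Finset.sum_le_sum fun j _ => mul_le_mul_of_nonneg_left ?_ (hν.1 j)
      simp only [e, L]
      split_ifs
      · simpa using (𝒢.loss_mem j x).1
      · simp
    have hμ1' : 0 < 1 - μ := by linarith
    suffices hfin : (1 - μ) * h ≤ 1 by linarith
    -- The opposite inequality `(1 - μ) * h ≤ 1` follows from `hl`. Generically the two excesses,
    -- scaled by `1 - μ`, are at most `s` and `1 - s`; `key` treats `s < μ`, where the bounds are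
    -- `μ` and `1 - μ`.
    have key : ∀ a b : Fin k, ∀ s : ℝ, 0 < s → s < 1 →
        (∀ x, (1 - μ) * 𝒢.loss l x ≤ (1 - s) * 𝒢.loss a x + s * 𝒢.loss b x) →
        s < μ → (1 - μ) * (𝒢.excess l a + 𝒢.excess l b) ≤ 1 := by
      intro a b s hs0 hs1 hl hsμ
      have h1 : 𝒢.excess l a ≤ μ / (1 - μ) := excess_le (by positivity) fun x => by
        rw [le_div_iff₀ hμ1']
        rcases le_or_gt (𝒢.loss l x - 𝒢.loss a x) 0 with hneg | hpos
        · nlinarith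
        · nlinarith [hl x, (𝒢.loss_mem l x).2, (𝒢.loss_mem b x).2]
      rw [le_div_iff₀ hμ1'] at h1
      nlinarith [excess_le_one (𝒢 := 𝒢) l b]
    rcases lt_or_ge s μ with hsμ | hsμ
    · exact key c p s hs0 hs1 hl hsμ
    rcases lt_or_ge (1 - s) μ with hsμ' | hsμ'
    · rw [hdef, add_comm]
      exact key p c (1 - s) (by linarith) (by linarith) (fun x => by linarith [hl x]) hsμ'
    have h1 : 𝒢.excess l c ≤ s / (1 - μ) := excess_le (by positivity) fun x => by
      rw [le_div_iff₀ hμ1']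
      nlinarith [hl x, (𝒢.loss_mem p x).2, (𝒢.loss_mem c x).1]
    have h2 : 𝒢.excess l p ≤ (1 - s) / (1 - μ) := excess_le
        (div_nonneg (by linarith) hμ1'.le) fun x => by
      rw [le_div_iff₀ hμ1']
      nlinarith [hl x, (𝒢.loss_mem c x).2, (𝒢.loss_mem p x).1]
    rw [le_div_iff₀ hμ1'] at h1 h2
    linarith

/-- Walk along the segment from `lam` to an interior point of the cell of `b`. An action other than
`b` that is optimal on the way loses to `b` at the far end, so it cannot also be worse than `b` at
`lam`. -/
theorem reflTransGen_of_le (hdup : 𝒢.HasNoDuplicates) (hnd : 𝒢.NonDegenerate)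
    {lam : Fin d → ℝ} {root b : Fin k} (hroot : lam ∈ 𝒢.cell root) (hb : (𝒢.cell b).Nonempty) :
    Relation.ReflTransGen (fun c c' => 𝒢.Neighbors c c' ∧
      c ∈ {a | 𝒢.loss a ⬝ᵥ lam ≤ 𝒢.loss b ⬝ᵥ lam} ∧
      c' ∈ {a | 𝒢.loss a ⬝ᵥ lam ≤ 𝒢.loss b ⬝ᵥ lam}) root b := by
  obtain ⟨u, hu, -, hus⟩ := (hnd.isPareto hb).exists_interior hdup
  refine reflTransGen_neighbors hdup hnd
    ((convex_stdSimplex ℝ _).segment_subset hroot.1 hu.1) (convex_segment _ _).isPreconnected ?_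
    (left_mem_segment ℝ _ _) (right_mem_segment ℝ _ _) hroot hu
  rintro _ ⟨s, t, hs, ht, hst, rfl⟩ a ha
  rw [mem_ofPred_eq]
  rcases eq_or_ne a b with rfl | hab
  · rfl
  have h1 := (mem_cell_iff.1 ha).2 b
  have h2 := hus a hab
  simp only [dotProduct_add, dotProduct_smul, smul_eq_mul] at h1
  rcases hs.eq_or_lt with rfl | hs
  · have : t = 1 := by linarith
    subst this
    linarith
  · by_contra! hlt
    nlinarith

/-- The set of weighted costs at which the loss difference of `c` and `root` can be estimated. -/
def estimationCost (𝒢 : PMGame k d S) (w : Fin k → ℝ) (root c : Fin k) : Set ℝ :=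
  {C | ∃ (F : Fin k → S → ℝ) (B : Fin k → ℝ), (∀ a, 0 ≤ B a) ∧
    (∀ a σ, |F a σ| ≤ 𝒢.maxSymbols * B a) ∧
    (∀ x, ∑ a, F a (𝒢.feedback a x) = 𝒢.loss c x - 𝒢.loss root x) ∧ C = ∑ a, B a * w a}

theorem estimationCost_nonneg {w : Fin k → ℝ} (hw : ∀ a, 0 ≤ w a) {root c : Fin k} {C : ℝ}
    (hC : C ∈ 𝒢.estimationCost w root c) : 0 ≤ C := by
  obtain ⟨F, B, hB, -, -, rfl⟩ := hC
  exact Finset.sum_nonneg fun a _ => mul_nonneg (hB a) (hw a)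

theorem estimationCost_self (w : Fin k → ℝ) (root : Fin k) :
    0 ∈ 𝒢.estimationCost w root root :=
  ⟨0, 0, by simp, by simp, by simp, by simp⟩

/-- Extending an estimator by one neighbour link makes the infimum of the costs a potential of the
kind bounded by `potential_sub_le`. -/
theorem estimationCost_add (hloc : 𝒢.LocallyObservable) {w : Fin k → ℝ} {root a c : Fin k}
    (h : 𝒢.Neighbors a c) {C : ℝ} (hC : C ∈ 𝒢.estimationCost w root c) :
    C + (𝒢.excess a c + 𝒢.excess c a) / 2 * (w a + w c) ∈ 𝒢.estimationCost w root a := by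
  obtain ⟨F, B, hB, hF, hsum, rfl⟩ := hC
  obtain ⟨f, g, hfg, hf, hg⟩ := hloc.exists_bounded h
  set o := (𝒢.excess a c + 𝒢.excess c a) / 2
  have ho : 0 ≤ o := by
    have := excess_nonneg (𝒢 := 𝒢) a c
    have := excess_nonneg (𝒢 := 𝒢) c a
    positivity
  refine ⟨fun e σ => F e σ + ((if e = a then f σ else 0) + if e = c then g σ else 0),
    fun e => B e + ((if e = a then o else 0) + if e = c then o else 0), fun e => ?_, fun e σ => ?_,
    fun x => ?_, ?_⟩
  · have := hB e
    dsimp only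
    split_ifs <;> positivity
  · rw [mul_add, mul_add]
    refine (abs_add_le _ _).trans (add_le_add (hF e σ) ((abs_add_le _ _).trans (add_le_add ?_ ?_)))
    · split_ifs
      · exact hf σ
      · simp
    · split_ifs
      · exact hg σ
      · simp
  · simp only [Finset.sum_add_distrib, Finset.sum_ite_eq', Finset.mem_univ, if_true]
    rw [hsum, hfg]
    ring
  · simp only [add_mul, ite_mul, zero_mul, Finset.sum_add_distrib, Finset.sum_ite_eq',
      Finset.mem_univ, if_true]
    ring

/-- Against a fixed outcome distribution `lam`, the loss difference of `b` and an optimal action can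
be estimated with small weights, both absolutely and relative to the regret at `lam`. -/
theorem exists_estimator_of_mem_cell (hdup : 𝒢.HasNoDuplicates) (hnd : 𝒢.NonDegenerate)
    (hloc : 𝒢.LocallyObservable) {lam : Fin d → ℝ} {root b : Fin k} (hroot : lam ∈ 𝒢.cell root)
    (hb : (𝒢.cell b).Nonempty) {r : ℝ} (hr : r < 𝒢.loss root ⬝ᵥ lam) :
    ∃ (F : Fin k → S → ℝ) (B : Fin k → ℝ), (∀ a, 0 ≤ B a) ∧
      (∀ a σ, |F a σ| ≤ 𝒢.maxSymbols * B a) ∧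
      (∀ x, ∑ a, F a (𝒢.feedback a x) = 𝒢.loss b x - 𝒢.loss root x) ∧
      ∑ a, B a ≤ 4 / 3 * k ∧
      ∑ a, B a * (𝒢.loss a ⬝ᵥ lam - r) ≤ 4 / 3 * k * (𝒢.loss b ⬝ᵥ lam - r) := by
  have hra : ∀ a, r < 𝒢.loss a ⬝ᵥ lam := fun a => hr.trans_le ((mem_cell_iff.1 hroot).2 a)
  set M := 𝒢.loss b ⬝ᵥ lam - r with hM
  have hM0 : 0 < M := sub_pos.2 (hra b)
  -- With this maximum a single weighted sum controls both the total size and the total regret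
  -- relative to `b`.
  let w : Fin k → ℝ := fun a => max 1 ((𝒢.loss a ⬝ᵥ lam - r) / M)
  have hw1 : ∀ a, 1 ≤ w a := fun a => le_max_left _ _
  have hw0 : ∀ a, 0 ≤ w a := fun a => zero_le_one.trans (hw1 a)
  have hwM : ∀ a, 𝒢.loss a ⬝ᵥ lam - r ≤ w a * M := fun a => by
    rw [← div_le_iff₀ hM0]
    exact le_max_right _ _
  have hlight : ∀ a, w a = 1 ↔ 𝒢.loss a ⬝ᵥ lam - r ≤ M := fun a => by
    simp only [w]
    rw [max_eq_left_iff, div_le_one hM0]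
  let V : Fin k → ℝ := fun c => sInf (𝒢.estimationCost w root c)
  have hbdd : ∀ c, BddBelow (𝒢.estimationCost w root c) := fun c =>
    ⟨0, fun C hC => estimationCost_nonneg hw0 hC⟩
  have hne : ∀ c, (𝒢.cell c).Nonempty → (𝒢.estimationCost w root c).Nonempty := by
    intro c hc
    have h := Relation.ReflTransGen.mono (p := 𝒢.Neighbors) (fun _ _ h => h.1) _ _
      (reflTransGen_of_le hdup hnd hroot hc)
    clear hc
    induction h with
    | refl => exact ⟨0, estimationCost_self w root⟩
    | tail _ hN ih =>
      obtain ⟨C, hC⟩ := ih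
      exact ⟨_, estimationCost_add hloc hN.symm hC⟩
  have hV : ∀ a c, 𝒢.Neighbors a c →
      V a - V c ≤ (𝒢.excess a c + 𝒢.excess c a) / 2 * (w a + w c) := by
    intro a c h
    rw [sub_le_comm]
    refine le_csInf (hne c h.2.1.1) fun C hC => ?_
    rw [sub_le_iff_le_add]
    exact csInf_le (hbdd a) (estimationCost_add hloc h hC)
  have hVroot : V root = 0 := le_antisymm (csInf_le (hbdd _) (estimationCost_self w root))
    (le_csInf (hne _ ⟨lam, hroot⟩) fun C hC => estimationCost_nonneg hw0 hC)
  have hVb := potential_sub_le (w := w) (V := V) (D := 𝒢.excess) (N := 𝒢.Neighbors)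
    (fun _ _ h => h.symm) hw1
    ((hlight root).2 (by rw [hM]; linarith [(mem_cell_iff.1 hroot).2 b])) excess_le_one hV
    (Relation.ReflTransGen.mono (fun c c' h => ⟨h.1, (hlight c).2 (sub_le_sub_right h.2.1 r),
      (hlight c').2 (sub_le_sub_right h.2.2 r)⟩) _ _
      (reflTransGen_of_le hdup hnd hroot hb)) ?_
  · rw [hVroot, sub_zero, Fintype.card_fin] at hVb
    -- The bound `4/3 * (k - 1) + 1` is strictly below `4/3 * k`; the slack yields an actual
    -- estimator although the infimum need not be attained.
    obtain ⟨C, ⟨F, B, hB, hF, hsum, rfl⟩, hC⟩ := exists_lt_of_csInf_lt (hne b hb)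
      (show V b < 4 / 3 * k by linarith)
    refine ⟨F, B, hB, hF, hsum, le_trans (Finset.sum_le_sum fun a _ => ?_) hC.le, ?_⟩
    · exact le_mul_of_one_le_right (hB a) (hw1 a)
    · refine le_trans ?_ (mul_le_mul_of_nonneg_right hC.le hM0.le)
      rw [Finset.sum_mul]
      refine Finset.sum_le_sum fun a _ => ?_
      rw [mul_assoc]
      exact mul_le_mul_of_nonneg_left (hwM a) (hB a)
  · intro l c p hlc hlp _ hc hp hcp hh
    refine Relation.ReflTransGen.mono ?_ _ _ (reflTransGen_bypass hdup hnd hroot.1 hra hlc.ne.symm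
      hlp.ne.symm hcp hlc.2.1.1 hlp.2.1.1 ((hlight c).1 hc) ((hlight p).1 hp) hh)
    have hK : ∀ z, (𝒢.loss z ⬝ᵥ lam - r) * (𝒢.excess l c + 𝒢.excess l p - 1) ≤
        (𝒢.excess l c + 𝒢.excess l p) * M →
        w z * (𝒢.excess l c + 𝒢.excess l p - 1) ≤ 𝒢.excess l c + 𝒢.excess l p := by
      intro z hz
      simp only [w]
      rw [max_mul_of_nonneg _ _ (by linarith), max_le_iff, one_mul, div_mul_eq_mul_div,
        div_le_iff₀ hM0]
      exact ⟨by linarith, hz⟩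
    exact fun z z' h => ⟨h.1, ⟨h.2.1.1, hK z h.2.1.2⟩, h.2.2.1, hK z' h.2.2.2⟩

end PMGame

end

/-! ### The exploration distribution and the minimax argument. -/

noncomputable section

open Set Matrix

/-- The shift `u₀ * M a` is spread over all actions and taken back at `b`, where the mass `q / 2`
pays for it, so the sum of the estimates is unchanged. Choosing `u₀` before `F` matters: one shift
must serve every outcome. -/
theorem sum_perspective_stab_le {γ q v : ℝ} (hγ : 2 ≤ γ) (h0 : 0 < q) (h1 : q < 1) (hv0 : 0 ≤ v)
    (hv : v ≤ 2 / 3) :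
    ∃ u₀ : ℝ, ∀ {ι : Type} [Fintype ι] [DecidableEq ι] (b : ι) (M F p : ι → ℝ), (∀ a, 0 ≤ M a) →
      ∑ a, M a ≤ 1 / 2 → (∀ a, |F a| ≤ v * M a) →
      (∀ a, q * ((if a = b then 1 / 2 else 0) + M a) ≤ p a) →
      ∑ a, p a * stab γ q ((F a + u₀ * M a - if a = b then u₀ * ∑ a, M a else 0) / p a) ≤
        9 / 32 * v ^ 2 * min q ((1 - q) / (γ * q)) := by
  have hγ0 : 0 ≤ γ := by linarith
  obtain ⟨u₀, hu1, hu2⟩ := exists_stab_shift hγ h0 h1 hv0 hv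
  refine ⟨u₀, ?_⟩
  intro ι _ _ b M F p hM hMs hF hp
  set R := min q ((1 - q) / (γ * q))
  set s := ∑ a, M a with hs
  have hs0 : 0 ≤ s := Finset.sum_nonneg fun a _ => hM a
  have hconv := stab_convexOn hγ0 h0 h1
  set A := max (stab γ q ((v + u₀) / q)) (stab γ q ((-v + u₀) / q)) with hA
  have hA0 : 0 ≤ A := (stab_nonneg hγ0 h0 h1 _).trans (le_max_left _ _)
  have hAR : A + stab γ q (-u₀ / q) ≤ 9 / 16 * v ^ 2 * (R / q) := by
    rcases max_choice (stab γ q ((v + u₀) / q)) (stab γ q ((-v + u₀) / q)) with h | h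
    · rw [hA, h]; exact hu1
    · rw [hA, h]; exact hu2
  have hterm : ∀ t, |t| ≤ v → stab γ q ((t + u₀) / q) ≤ A := by
    intro t ht
    rw [abs_le] at ht
    have hmem : (t + u₀) / q ∈ segment ℝ ((v + u₀) / q) ((-v + u₀) / q) := by
      rw [segment_symm, segment_eq_Icc (by gcongr; linarith)]
      constructor <;> gcongr
      · exact ht.1
      · exact ht.2
    exact hconv.le_on_segment trivial trivial hmem
  have hcomp : stab γ q (-(u₀ * s) / (q * (1 / 2))) ≤ stab γ q (-u₀ / q) := by
    have := hconv.2 (mem_univ (-u₀ / q)) (mem_univ 0) (show 0 ≤ 2 * s by linarith)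
      (show 0 ≤ 1 - 2 * s by linarith) (by ring)
    rw [stab_zero hγ0 h0 h1] at this
    simp only [smul_eq_mul, mul_zero, add_zero] at this
    -- As `2 * s ≤ 1`, convexity and the zero at the origin bound this by the full compensation.
    rw [show -(u₀ * s) / (q * (1 / 2)) = 2 * s * (-u₀ / q) by field_simp]
    refine this.trans (mul_le_of_le_one_left (stab_nonneg hγ0 h0 h1 _) (by linarith))
  have hbound : ∀ a, p a * stab γ q ((F a + u₀ * M a - if a = b then u₀ * s else 0) / p a) ≤
      q * M a * A + if a = b then q * (1 / 2) * stab γ q (-u₀ / q) else 0 := by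
    intro a
    have hqM : 0 ≤ q * M a := mul_nonneg h0.le (hM a)
    have hz : q * M a = 0 → F a + u₀ * M a = 0 := by
      intro h
      have hMa : M a = 0 := (mul_eq_zero.1 h).resolve_left h0.ne'
      have := hF a
      rw [hMa, mul_zero] at this
      rw [hMa, abs_nonpos_iff.1 this]
      simp
    have hfirst : q * M a * stab γ q ((F a + u₀ * M a) / (q * M a)) ≤ q * M a * A := by
      rcases (hM a).eq_or_lt with h | h
      · simp [← h]
      · refine mul_le_mul_of_nonneg_left ?_ hqM
        rw [show (F a + u₀ * M a) / (q * M a) = (F a / M a + u₀) / q by field_simp]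
        refine hterm _ ?_
        rw [abs_div, abs_of_pos h, div_le_iff₀ h]
        exact hF a
    have hpa := hp a
    split_ifs at hpa ⊢ with hab
    · have h2 := stab_perspective_add_le hγ0 h0 h1 (g₂ := -(u₀ * s)) hqM
        (show 0 ≤ q * (1 / 2) by positivity) hz
        (fun h => absurd h (by positivity))
      rw [← sub_eq_add_neg] at h2
      refine (stab_perspective_mono hγ0 h0 h1 (by positivity : 0 ≤ q * M a + q * (1 / 2))
        (by linarith) fun h => ?_).trans (h2.trans (add_le_add hfirst ?_))
      · nlinarith
      · exact mul_le_mul_of_nonneg_left hcomp (by positivity)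
    · rw [sub_zero, add_zero]
      exact (stab_perspective_mono hγ0 h0 h1 hqM (by linarith) hz).trans hfirst
  refine (Finset.sum_le_sum fun a _ => hbound a).trans ?_
  rw [Finset.sum_add_distrib, Finset.sum_ite_eq' Finset.univ b, if_pos (Finset.mem_univ _),
    ← Finset.sum_mul, ← Finset.mul_sum, ← hs]
  have h3 := mul_le_mul_of_nonneg_left hAR (show 0 ≤ q * (1 / 2) by positivity)
  have h4 : q * (1 / 2) * (9 / 16 * v ^ 2 * (R / q)) = 9 / 32 * v ^ 2 * R := by field_simp; ring
  have h5 : q * s * A ≤ q * (1 / 2) * A := by gcongr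
  linarith

namespace PMGame

variable {k d : ℕ} {S : Type*} {𝒢 : PMGame k d S}

theorem convex_halfSimplex (q : Fin k → ℝ) : Convex ℝ (halfSimplex q) := by
  rintro p ⟨hp, hp'⟩ p' ⟨hq, hq'⟩ s t hs ht hst
  refine ⟨convex_stdSimplex ℝ _ hp hq hs ht hst, fun a => ?_⟩
  have h1 := mul_le_mul_of_nonneg_left (hp' a) hs
  have h2 := mul_le_mul_of_nonneg_left (hq' a) ht
  simp only [Pi.add_apply, Pi.smul_apply, smul_eq_mul]
  have : s * (q a / 2) + t * (q a / 2) = q a / 2 := by rw [← add_mul, hst, one_mul]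
  linarith

theorem convex_lossDiffEstimators : Convex ℝ 𝒢.lossDiffEstimators := by
  intro G hG G' hG' s t hs ht hst b c hb hc x
  have h1 := hG b c hb hc x
  have h2 := hG' b c hb hc x
  calc _ = s * ∑ a, (G a (𝒢.feedback a x) b - G a (𝒢.feedback a x) c) +
        t * ∑ a, (G' a (𝒢.feedback a x) b - G' a (𝒢.feedback a x) c) := by
        rw [Finset.mul_sum, Finset.mul_sum, ← Finset.sum_add_distrib]
        refine Finset.sum_congr rfl fun a _ => ?_
        simp only [Pi.add_apply, Pi.smul_apply, smul_eq_mul]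
        ring
    _ = _ := by rw [h1, h2, ← add_mul, hst, one_mul]

/-- The quantity whose maximum over the outcomes is the objective. -/
def exoValue (𝒢 : PMGame k d S) (γ : ℝ) (β q p : Fin k → ℝ) (G : Fin k → S → Fin k → ℝ)
    (x : Fin d) : ℝ :=
  ∑ a, (p a - q a) * 𝒢.loss a x +
    ∑ b, β b * ∑ a, p a * stab γ (q b) (G a (𝒢.feedback a x) b / (β b * p a))

theorem convexOn_exoValue {γ : ℝ} (hγ : 0 ≤ γ) {β q : Fin k → ℝ} (hβ : ∀ b, 0 < β b)
    (hq : ∀ b, q b ∈ Ioo (0 : ℝ) 1) (x : Fin d) :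
    ConvexOn ℝ (halfSimplex q ×ˢ 𝒢.lossDiffEstimators)
      fun e => 𝒢.exoValue γ β q e.1 e.2 x := by
  refine ⟨(convex_halfSimplex q).prod convex_lossDiffEstimators, ?_⟩
  rintro ⟨p, G⟩ ⟨hp, -⟩ ⟨p', G'⟩ ⟨hp', -⟩ s t hs ht hst
  have hpos : ∀ {p}, p ∈ halfSimplex q → ∀ a, 0 < p a := fun hp a => by
    linarith [hp.2 a, (hq a).1]
  simp only [exoValue, smul_eq_mul]
  rw [mul_add, mul_add, add_add_add_comm]
  refine add_le_add (le_of_eq ?_) ?_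
  · rw [Finset.mul_sum, Finset.mul_sum, ← Finset.sum_add_distrib]
    refine Finset.sum_congr rfl fun a _ => ?_
    simp only [Prod.fst_add, Prod.smul_fst, Pi.add_apply, Pi.smul_apply, smul_eq_mul]
    linear_combination q a * 𝒢.loss a x * hst
  · rw [Finset.mul_sum, Finset.mul_sum, ← Finset.sum_add_distrib]
    refine Finset.sum_le_sum fun b _ => ?_
    rw [mul_left_comm s, mul_left_comm t, ← mul_add, Finset.mul_sum _ _ s,
      Finset.mul_sum _ _ t, ← Finset.sum_add_distrib]
    refine mul_le_mul_of_nonneg_left (Finset.sum_le_sum fun a _ => ?_) (hβ b).le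
    simp only [Prod.fst_add, Prod.smul_fst, Prod.snd_add, Prod.smul_snd, Pi.add_apply,
      Pi.smul_apply, smul_eq_mul]
    have h := stab_perspective_add_le hγ (hq b).1 (hq b).2
      (g₁ := s * (G a (𝒢.feedback a x) b / β b)) (g₂ := t * (G' a (𝒢.feedback a x) b / β b))
      (mul_nonneg hs (hpos hp a).le) (mul_nonneg ht (hpos hp' a).le)
      (fun h => by rw [(mul_eq_zero.1 h).resolve_right (hpos hp a).ne', zero_mul])
      (fun h => by rw [(mul_eq_zero.1 h).resolve_right (hpos hp' a).ne', zero_mul])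
    have e : ∀ s g p : ℝ, s * p * stab γ (q b) (s * (g / β b) / (s * p)) =
        s * (p * stab γ (q b) (g / (β b * p))) := by
      intro s g p
      rcases eq_or_ne s 0 with rfl | hs
      · simp
      · rw [mul_div_mul_left _ _ hs, div_div, mul_assoc]
    rw [e, e, ← mul_div_assoc, ← mul_div_assoc, ← add_div, div_div] at h
    exact h

/-- Against a fixed outcome distribution there are a sampling distribution and an estimator with
small transformation cost and small stability cost. -/
theorem exists_exploration (hdup : 𝒢.HasNoDuplicates) (hnd : 𝒢.NonDegenerate)
    (hloc : 𝒢.LocallyObservable) {γ : ℝ} (hγ : 2 ≤ γ) {β q : Fin k → ℝ} (hβ0 : ∀ b, 0 < β b)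
    (hβ : ∀ b, 4 * (𝒢.maxSymbols : ℝ) * (k : ℝ) ≤ β b)
    (hq : q ∈ stdSimplex ℝ (Fin k)) (hq_int : ∀ b, q b ∈ Ioo (0 : ℝ) 1) (hk : 0 < k)
    {lam : Fin d → ℝ} (hlam : lam ∈ stdSimplex ℝ (Fin d)) {ε : ℝ} (hε : 0 < ε) :
    ∃ p ∈ halfSimplex q, ∃ G ∈ 𝒢.lossDiffEstimators,
      ∑ a, (p a - q a) * (𝒢.loss a ⬝ᵥ lam) ≤ ε ∧
      ∀ x, ∑ b, β b * ∑ a, p a * stab γ (q b) (G a (𝒢.feedback a x) b / (β b * p a)) ≤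
        2 * (𝒢.maxSymbols : ℝ) ^ 2 * (k : ℝ) ^ 2 *
          ∑ b, 1 / β b * min (q b) ((1 - q b) / (γ * q b)) := by
  have : Nonempty (Fin k) := ⟨⟨0, hk⟩⟩
  have hk0 : (0 : ℝ) < k := by exact_mod_cast hk
  obtain ⟨root, hroot⟩ := exists_mem_cell (𝒢 := 𝒢) hlam
  -- The reference level is strictly below the optimum, so that every regret is positive and can be
  -- divided by.
  set r := 𝒢.loss root ⬝ᵥ lam - ε with hr
  have hra : ∀ a, r < 𝒢.loss a ⬝ᵥ lam := fun a => by
    linarith [(mem_cell_iff.1 hroot).2 a]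
  have hest : ∀ b, ∃ (F : Fin k → S → ℝ) (B : Fin k → ℝ), (∀ a, 0 ≤ B a) ∧
      (∀ a σ, |F a σ| ≤ 𝒢.maxSymbols * B a) ∧
      (𝒢.IsPareto b → ∀ x, ∑ a, F a (𝒢.feedback a x) = 𝒢.loss b x - 𝒢.loss root x) ∧
      ∑ a, B a ≤ 4 / 3 * k ∧
      ∑ a, B a * (𝒢.loss a ⬝ᵥ lam - r) ≤ 4 / 3 * k * (𝒢.loss b ⬝ᵥ lam - r) := by
    intro b
    by_cases hb : 𝒢.IsPareto b
    · obtain ⟨F, B, h1, h2, h3, h4, h5⟩ := exists_estimator_of_mem_cell hdup hnd hloc hroot hb.1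
        (hra root)
      exact ⟨F, B, h1, h2, fun _ => h3, h4, h5⟩
    · refine ⟨0, 0, by simp, by simp, fun h => absurd h hb, by simp, ?_⟩
      have := sub_pos.2 (hra b)
      simp only [Pi.zero_apply, zero_mul, Finset.sum_const_zero]
      positivity
  choose F B hB hF hsum hB1 hB2 using hest
  -- The scale `3 / (8 * k)` used in `M` brings the total mass `4/3 * k` down to `1 / 2`, and this
  -- `v` is the resulting ratio of `m * B / β` to `M`. The condition `β ≥ 4 * m * k` is exactly `v ≤
  -- 2 / 3`.
  have hv : ∀ b, 0 ≤ 8 / 3 * 𝒢.maxSymbols * k / β b ∧ 8 / 3 * 𝒢.maxSymbols * k / β b ≤ 2 / 3 := by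
    intro b
    have := hβ0 b
    refine ⟨by positivity, ?_⟩
    rw [div_le_iff₀ this]
    linarith [hβ b]
  choose u hu using fun b => sum_perspective_stab_le hγ (hq_int b).1 (hq_int b).2 (hv b).1 (hv b).2
  let M : Fin k → Fin k → ℝ := fun b a => 3 / (8 * k) * B b a
  have hM0 : ∀ b a, 0 ≤ M b a := fun b a => mul_nonneg (by positivity) (hB b a)
  have hM1 : ∀ b, ∑ a, M b a ≤ 1 / 2 := by
    intro b
    rw [← Finset.mul_sum]
    calc _ ≤ 3 / (8 * k) * (4 / 3 * (k : ℝ)) := by gcongr; exact hB1 b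
      _ = 1 / 2 := by field_simp; norm_num
  have hM2 : ∀ b, ∑ a, M b a * (𝒢.loss a ⬝ᵥ lam - r) ≤ 1 / 2 * (𝒢.loss b ⬝ᵥ lam - r) := by
    intro b
    simp only [M, mul_assoc]
    rw [← Finset.mul_sum]
    calc _ ≤ 3 / (8 * k) * (4 / 3 * (k : ℝ) * (𝒢.loss b ⬝ᵥ lam - r)) := by gcongr; exact hB2 b
      _ = _ := by field_simp; ring
  -- Half of each `q b` stays at `b`. The other half is moved to `M b`, whose regret is at most half
  -- that of `b`, and what is left goes to `root`, whose regret relative to `r` is `ε`.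
  let p : Fin k → ℝ := fun a => q a / 2 + ∑ b, q b * M b a +
    if a = root then ∑ b, q b * (1 / 2 - ∑ a, M b a) else 0
  have hrest : 0 ≤ ∑ b, q b * (1 / 2 - ∑ a, M b a) :=
    Finset.sum_nonneg fun b _ => mul_nonneg (hq.1 b) (sub_nonneg.2 (hM1 b))
  have hmix : ∀ a, 0 ≤ ∑ b, q b * M b a := fun a =>
    Finset.sum_nonneg fun b _ => mul_nonneg (hq.1 b) (hM0 b a)
  have hp2 : ∀ a, q a / 2 + ∑ b, q b * M b a ≤ p a := fun a => by
    simp only [p]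
    split_ifs <;> linarith
  have hpsum : ∀ f : Fin k → ℝ, ∑ a, p a * f a =
      ∑ b, q b * (f b / 2 + ∑ a, M b a * f a + (1 / 2 - ∑ a, M b a) * f root) := by
    intro f
    simp only [p, add_mul, ite_mul, zero_mul, Finset.sum_add_distrib, Finset.sum_ite_eq',
      Finset.mem_univ, if_true, mul_add, Finset.sum_mul, Finset.mul_sum]
    congr 1
    · congr 1
      · exact Finset.sum_congr rfl fun a _ => by ring
      · rw [Finset.sum_comm]
        exact Finset.sum_congr rfl fun a _ => Finset.sum_congr rfl fun _ _ => by ring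
    · exact Finset.sum_congr rfl fun a _ => by ring
  have hpS : p ∈ halfSimplex q := by
    refine ⟨⟨fun a => ?_, ?_⟩, fun a => ?_⟩
    · linarith [hp2 a, hmix a, hq.1 a]
    · have := hpsum 1
      simp only [Pi.one_apply, mul_one] at this
      refine this.trans (Eq.trans ?_ hq.2)
      exact Finset.sum_congr rfl fun b _ => by ring
    · linarith [hp2 a, hmix a]
  let G : Fin k → S → Fin k → ℝ := fun a σ b =>
    β b * (F b a σ / β b + u b * M b a - if a = b then u b * ∑ a, M b a else 0)
  have hG : ∀ b, 𝒢.IsPareto b → ∀ x, ∑ a, G a (𝒢.feedback a x) b =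
      𝒢.loss b x - 𝒢.loss root x := by
    intro b hb x
    simp only [G]
    rw [← Finset.mul_sum, Finset.sum_sub_distrib, Finset.sum_add_distrib, Finset.sum_ite_eq',
      if_pos (Finset.mem_univ _), ← Finset.mul_sum, add_sub_cancel_right, ← Finset.sum_div,
      mul_div_cancel₀ _ (hβ0 b).ne', hsum b hb x]
  refine ⟨p, hpS, G, fun b c hb hc x => ?_, ?_, fun x => ?_⟩
  · rw [Finset.sum_sub_distrib, hG b hb, hG c hc]
    ring
  · simp only [sub_mul, Finset.sum_sub_distrib, hpsum]
    rw [← Finset.sum_sub_distrib]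
    calc _ ≤ ∑ b, q b * ε := Finset.sum_le_sum fun b _ => ?_
      _ = ε := by rw [← Finset.sum_mul, hq.2, one_mul]
    rw [← mul_sub]
    refine mul_le_mul_of_nonneg_left ?_ (hq.1 b)
    have h1 := hM2 b
    simp only [mul_sub, Finset.sum_sub_distrib, ← Finset.sum_mul] at h1
    have h2 : 0 ≤ ∑ a, M b a := Finset.sum_nonneg fun a _ => hM0 b a
    have h3 : 𝒢.loss root ⬝ᵥ lam = r + ε := by rw [hr]; ring
    rw [h3]
    nlinarith
  · rw [Finset.mul_sum]
    refine Finset.sum_le_sum fun b _ => ?_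
    have h := hu b b (M b) (fun a => F b a (𝒢.feedback a x) / β b) p (hM0 b) (hM1 b)
      (fun a => ?_) fun a => ?_
    · have e : ∀ a, G a (𝒢.feedback a x) b / (β b * p a) =
          (F b a (𝒢.feedback a x) / β b + u b * M b a -
            if a = b then u b * ∑ a, M b a else 0) / p a := fun a => by
        simp only [G]
        rw [mul_div_mul_left _ _ (hβ0 b).ne']
      simp only [e]
      refine (mul_le_mul_of_nonneg_left h (hβ0 b).le).trans (le_of_eq ?_)
      have := (hβ0 b).ne'
      field_simp
      ring
    · rw [abs_div, abs_of_pos (hβ0 b), div_mul_eq_mul_div, div_le_div_iff_of_pos_right (hβ0 b)]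
      refine (hF b a _).trans (le_of_eq ?_)
      simp only [M]
      field_simp
    · refine le_trans ?_ (hp2 a)
      rw [mul_add]
      refine add_le_add ?_ (Finset.single_le_sum (f := fun b => q b * M b a)
        (fun b _ => mul_nonneg (hq.1 b) (hM0 b a)) (Finset.mem_univ b))
      split_ifs with h
      · rw [h]; linarith
      · linarith [hq.1 a]

end PMGame

theorem mainTheorem3 {k d : ℕ} {S : Type*} (𝒢 : PMGame k d S)
    (hdup : 𝒢.HasNoDuplicates) (hnd : 𝒢.NonDegenerate) (hloc : 𝒢.LocallyObservable)
    (γ : ℝ) (hγ : 2 ≤ γ)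
    (β : Fin k → ℝ) (hβ : ∀ b, 4 * (𝒢.maxSymbols : ℝ) * (k : ℝ) ≤ β b)
    (q : Fin k → ℝ) (hq : q ∈ stdSimplex ℝ (Fin k)) (hq_int : ∀ b, q b ∈ Set.Ioo (0 : ℝ) 1) :
    𝒢.exoOpt γ β q ≤
      ((2 * (𝒢.maxSymbols : ℝ) ^ 2 * (k : ℝ) ^ 2 *
        ∑ b, 1 / β b * min (q b) ((1 - q b) / (γ * q b)) : ℝ) : EReal) := by
  have hk : 1 < k := by
    by_contra! hk
    interval_cases k
    · simpa using hq.2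
    · have h1 := hq.2
      have h2 := (hq_int 0).2
      simp only [Finset.univ_unique, Fin.default_eq_zero, Finset.sum_singleton] at h1
      linarith
  have hd : 0 < d := by
    rw [pos_iff_ne_zero]
    rintro rfl
    exact hdup ⟨0, by omega⟩ ⟨1, hk⟩ (by simp) (Subsingleton.elim _ _)
  have : Nonempty (Fin d) := ⟨⟨0, hd⟩⟩
  have hm : 0 < 𝒢.maxSymbols :=
    ((Set.ncard_pos (Set.finite_range _)).2 (Set.range_nonempty _)).trans_le
      (PMGame.ncard_range_feedback_le (𝒢 := 𝒢) ⟨0, by omega⟩)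
  have hβ0 : ∀ b, 0 < β b := fun b => by
    have hm' : (0 : ℝ) < 𝒢.maxSymbols := by exact_mod_cast hm
    have hk' : (0 : ℝ) < k := by exact_mod_cast (by omega : 0 < k)
    exact lt_of_lt_of_le (by positivity) (hβ b)
  -- The alternative needs strict inequalities, so a margin `z - C` is left, half of which absorbs
  -- the transformation cost.
  refine EReal.le_of_forall_lt_iff_le.1 fun z hz => ?_
  set C := 2 * (𝒢.maxSymbols : ℝ) ^ 2 * (k : ℝ) ^ 2 *
    ∑ b, 1 / β b * min (q b) ((1 - q b) / (γ * q b))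
  have hz : C < z := by exact_mod_cast hz
  obtain ⟨⟨p, G⟩, ⟨hp, hG⟩, hx⟩ := exists_forall_neg_of_convexOn
    ((PMGame.convex_halfSimplex q).prod PMGame.convex_lossDiffEstimators)
    (f := fun x e => 𝒢.exoValue γ β q e.1 e.2 x + -z)
    (fun x => (PMGame.convexOn_exoValue (by linarith) hβ0 hq_int x).add_const (-z)) fun lam hlam => by
      obtain ⟨p, hp, G, hG, h1, h2⟩ := PMGame.exists_exploration hdup hnd hloc hγ hβ0 hβ hq hq_int
        (by omega) hlam (ε := (z - C) / 2) (by linarith)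
      refine ⟨(p, G), ⟨hp, hG⟩, ?_⟩
      have h3 : ∑ x, lam x * ∑ a, (p a - q a) * 𝒢.loss a x =
          ∑ a, (p a - q a) * (𝒢.loss a ⬝ᵥ lam) := by
        simp only [dotProduct, Finset.mul_sum]
        rw [Finset.sum_comm]
        exact Finset.sum_congr rfl fun a _ => Finset.sum_congr rfl fun x _ => by ring
      have h4 := Finset.sum_le_sum fun x (_ : x ∈ Finset.univ) =>
        mul_le_mul_of_nonneg_left (h2 x) (hlam.1 x)
      rw [← Finset.sum_mul, hlam.2, one_mul] at h4
      simp only [PMGame.exoValue, mul_add, Finset.sum_add_distrib, ← Finset.sum_mul, hlam.2, h3]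
      linarith
  refine (iInf₂_le p hp).trans ((iInf₂_le G hG).trans ?_)
  rw [EReal.coe_le_coe_iff]
  exact ciSup_le fun x => by
    have := hx x
    simp only [PMGame.exoValue] at this
    linarith

end
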